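/- **Notation.** For $v\in\mathbb R^m$ put $\hat v=v/\|v\|$ (Euclidean norm) if $v\ne 0$, and $\hat 0=0$. For a matrix $A$ with columns $a_1,\dots,a_n$ let $\hat A=[\hat a_1,\dots,\hat a_n]$ and let $$\rho_A=\max_{y\in\operatorname{im}(A)\setminus\{0\}}\ \min_{1\le j\le n}\hat a_j^{\mathsf T}\hat y$$ be Goffin's condition measure (with the maximum over the empty set, which occurs only for $A=0$, read as $-\infty$). The encoding size of an integer matrix is $\sum_{i,j}\bigl(1+\lceil\log_2(|a_{ij}|+1)\rceil\bigr)$. **Full Support Kernel Algorithm** on an input matrix $A\in\mathbb R^{m\times n}$, with $\varepsilon=\frac1{11m}$. Let $\Pi$ be the matrix of the orthogonal projection of $\mathbb R^n$ to $\ker A$ for the input matrix $A$; set $x_j:=1$ for all $j$, and $y:=Ax$. While $\Pi x\not>0$, let $k$ be an index minimizing $\hat a_j^{\mathsf T}\hat y$ over $j$ (ties are resolved arbitrarily); if $\hat a_k^{\mathsf T}\hat y<-\varepsilon$, update $$x:=x-\frac{a_k^{\mathsf T}y}{\|a_k\|^2}\,\vec e_k,\qquad y:=y-(\hat a_k^{\mathsf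 T}y)\,\hat a_k;$$ otherwise rescale $$A:=(I_m+\hat y\hat y^{\mathsf T})A,\qquad y:=2y.$$ Return $\bar x=\Pi x$. **Statement.** There is an absolute constant $C$ such that the following holds for all $m,n\ge 1$ and every $A\in\mathbb Z^{m\times n}$ of encoding size $L$ with $\rho_A<0$. Applied to $\hat A$, every run of the Full Support Kernel Algorithm terminates, and the returned vector $\bar x$ satisfies $\hat A\bar x=0$, $\bar x>0$. Moreover the algorithm, for every way of resolving ties, is carried out in at most $C\,(m^3n+mn^2)\,L$ arithmetic operations on real numbers (additions, subtractions, multiplications, divisions and comparisons), where the input of the computation is the real matrix $\hat A$, by the following implementation: $\Pi$ is computed once; $F=A^{\mathsf T}A$, $z=A^{\mathsf T}y$ and $\bar x=\Pi x$ are computed initially and then updated together with $A$, $x$ and $y$ in each iteration; and $k$ is found by one scan of the columns, which compares the numbers $z_j|z_j|/F_{jj}$ (read as $0$ if $F_{jj}=0$). -/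

import Mathlib

open Matrix

/-! ## Geometry: normalization, Goffin's measure, projections, encoding size -/

noncomputable section

namespace FullSupportKernel

/-- The Euclidean norm of `v`. -/
def enorm2 {m : ℕ} (v : Fin m → ℝ) : ℝ := √(v ⬝ᵥ v)

/-- The normalized vector `v / ‖v‖`, with the convention that the zero vector is sent to zero. -/
def hat {m : ℕ} (v : Fin m → ℝ) : Fin m → ℝ := fun i => v i / enorm2 v

/-- The matrix whose columns are the normalized columns of `A`. -/
def hatMatrix {m n : ℕ} (A : Matrix (Fin m) (Fin n) ℝ) : Matrix (Fin m) (Fin n) ℝ :=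
  Matrix.of fun i j => hat (A.col j) i

/-- Goffin's condition measure, the maximum over `y` in the image of `A`, `y ≠ 0`, of the minimum
over `j` of the cosine of the angle between `y` and column `j`. It takes values in `EReal`, so that
the maximum over the empty set (which occurs only if `A = 0`) is `-∞`. -/
def goffin {m n : ℕ} (A : Matrix (Fin m) (Fin n) ℝ) : EReal :=
  ⨆ y ∈ {y : Fin m → ℝ | y ∈ Set.range A.mulVec ∧ y ≠ 0},
    ⨅ j : Fin n, ((hat (A.col j) ⬝ᵥ hat y : ℝ) : EReal)

/-- The orthogonal projection of `x` to the kernel of `A`. -/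
def projKer {m n : ℕ} (A : Matrix (Fin m) (Fin n) ℝ) (x : Fin n → ℝ) : Fin n → ℝ :=
  WithLp.ofLp ((LinearMap.ker (Matrix.toEuclideanLin A)).starProjection (WithLp.toLp 2 x))

/-- The encoding size of an integer matrix in binary: each entry `a` takes one bit for the sign and
`⌈log₂ (|a| + 1)⌉` bits for the absolute value. -/
def encodingSize {m n : ℕ} (A : Matrix (Fin m) (Fin n) ℤ) : ℕ :=
  ∑ i, ∑ j, (1 + Nat.size (A i j).natAbs)

/-- `x` is a solution of the kernel problem `A x = 0`, `x > 0`. -/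
def KernelFeasible {m n : ℕ} (A : Matrix (Fin m) (Fin n) ℝ) (x : Fin n → ℝ) : Prop :=
  A *ᵥ x = 0 ∧ ∀ j, 0 < x j

/-! ## The Full Support Kernel Algorithm -/

/-- The values of the variables `A`, `x`, `y` during the algorithm. -/
structure State (m n : ℕ) where
  A : Matrix (Fin m) (Fin n) ℝ
  x : Fin n → ℝ
  y : Fin m → ℝ

/-- The threshold of the algorithm. -/
def eps (m : ℕ) : ℝ := 1 / (11 * (m : ℝ))

/-- The cosine of the angle between `y` and column `j` of the current matrix. -/
def State.cosine {m n : ℕ} (s : State m n) (j : Fin n) : ℝ := hat (s.A.col j) ⬝ᵥ hat s.y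

/-- `k` attains the minimum of the cosines. -/
def State.IsArgmin {m n : ℕ} (s : State m n) (k : Fin n) : Prop :=
  ∀ j, s.cosine k ≤ s.cosine j

/-- The initial state for input `A₀`: the vector `x` is the all-ones vector and `y = A₀ x`. -/
def start {m n : ℕ} (A₀ : Matrix (Fin m) (Fin n) ℝ) : State m n :=
  ⟨A₀, fun _ => 1, A₀ *ᵥ (fun _ => 1)⟩

/-- The stopping test: the projection of `x` to the kernel of the input matrix is positive. -/
def Stops {m n : ℕ} (A₀ : Matrix (Fin m) (Fin n) ℝ) (s : State m n) : Prop :=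
  ∀ j, 0 < projKer A₀ s.x j

/-- One iteration of the while loop on input `A₀`. The choice among several minimizers `k` is left
open. -/
inductive Step {m n : ℕ} (A₀ : Matrix (Fin m) (Fin n) ℝ) : State m n → State m n → Prop
  | update (s : State m n) (k : Fin n) (hs : ¬ Stops A₀ s) (hk : s.IsArgmin k)
      (hc : s.cosine k < -eps m) :
      Step A₀ s
        ⟨s.A,
         s.x - ((s.A.col k ⬝ᵥ s.y) / enorm2 (s.A.col k) ^ 2) • Pi.single k (1 : ℝ),
         s.y - (hat (s.A.col k) ⬝ᵥ s.y) • hat (s.A.col k)⟩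
  | rescale (s : State m n) (k : Fin n) (hs : ¬ Stops A₀ s) (hk : s.IsArgmin k)
      (hc : ¬ s.cosine k < -eps m) :
      Step A₀ s
        ⟨(1 + Matrix.vecMulVec (hat s.y) (hat s.y)) * s.A, s.x, (2 : ℝ) • s.y⟩

/-- Some run of the algorithm on input `A₀` stops and returns `xbar`. -/
def Returns {m n : ℕ} (A₀ : Matrix (Fin m) (Fin n) ℝ) (xbar : Fin n → ℝ) : Prop :=
  ∃ s, Relation.ReflTransGen (Step A₀) (start A₀) s ∧ Stops A₀ s ∧ xbar = projKer A₀ s.x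

end FullSupportKernel

end

/-! ## Counting arithmetic operations

A program of the real model of computation is written below from the primitives `plus`, `minus`,
`times`, `divide`, `less` and `isZero`, each of which costs one operation; scalars are produced and
compared only by them, apart from copying and from natural-number constants. Programs are written
over an arbitrary field of scalars. -/

namespace FullSupportKernel

/-- The result of a computation, with the number of arithmetic operations and comparisons spent. -/
structure Counted (α : Type) where
  val : α
  ops : ℕ

namespace Counted

instance : Monad Counted where
  pure a := ⟨a, 0⟩
  bind c f := ⟨(f c.val).val, c.ops + (f c.val).ops⟩

variable {K : Type} [Field K] [LinearOrder K]

def plus (a b : K) : Counted K := ⟨a + b, 1⟩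
def minus (a b : K) : Counted K := ⟨a - b, 1⟩
def times (a b : K) : Counted K := ⟨a * b, 1⟩
def divide (a b : K) : Counted K := ⟨a / b, 1⟩
def less (a b : K) : Counted Bool := ⟨decide (a < b), 1⟩
def isZero (a : K) : Counted Bool := ⟨decide (a = 0), 1⟩

/-- Compute and store `f i` for all `i`; the costs add up. -/
def table {n : ℕ} {α : Type} (f : Fin n → Counted α) : Counted (Fin n → α) :=
  ⟨fun i => (f i).val, ∑ i, (f i).ops⟩

/-- Compute the entries of a matrix one by one. -/
def tableMatrix {m n : ℕ} (f : Fin m → Fin n → Counted K) : Counted (Matrix (Fin m) (Fin n) K) :=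
  ⟨Matrix.of fun i j => (f i j).val, ∑ i, ∑ j, (f i j).ops⟩

/-- The inner product, by a loop that accumulates the products. -/
def inner {n : ℕ} (u v : Fin n → K) : Counted K :=
  (List.finRange n).foldlM (fun acc i => do
    let p ← times (u i) (v i)
    plus acc p) 0

/-- Test whether all entries of `v` are positive. -/
def allPos {n : ℕ} (v : Fin n → K) : Counted Bool :=
  (List.finRange n).foldlM (fun b i => do
    let p ← less 0 (v i)
    pure (b && p)) true

end Counted

open Counted

section Program

variable {K : Type} [Field K] [LinearOrder K] {m n : ℕ}

/-- The matrix of the orthogonal projection to the kernel of `A`. Starting from the identity, the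
rows `r` of `A` are processed in turn: the current projection `P` is replaced by
`P - v vᵀ / ‖v‖²` for `v = P r`, unless `v = 0`. -/
def kernelProjection (A : Matrix (Fin m) (Fin n) K) : Counted (Matrix (Fin n) (Fin n) K) :=
  (List.finRange m).foldlM (fun P i => do
    let v ← table fun j => inner (P j) (A i)
    let q ← inner v v
    let b ← isZero q
    if b then pure P
    else tableMatrix fun j l => do
      let p ← times (v j) (v l)
      let r ← divide p q
      minus (P j l) r) 1

/-- The data kept by the program: the current `A`, `x`, `y`, and
`F = Aᵀ A`, `z = Aᵀ y`, and the projection `xbar` of `x`. -/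
structure Memory (K : Type) (m n : ℕ) where
  A : Matrix (Fin m) (Fin n) K
  F : Matrix (Fin n) (Fin n) K
  x : Fin n → K
  y : Fin m → K
  z : Fin n → K
  xbar : Fin n → K

/-- The memory before the first iteration; `P` is the projection matrix. -/
def prepare (A : Matrix (Fin m) (Fin n) K) (P : Matrix (Fin n) (Fin n) K) :
    Counted (Memory K m n) := do
  let x : Fin n → K := fun _ => 1
  let y ← table fun i => inner (A i) x
  let F ← tableMatrix fun j l => inner (A.col j) (A.col l)
  let z ← table fun j => inner (A.col j) y
  let xbar ← table fun j => inner (P j) x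
  pure ⟨A, F, x, y, z, xbar⟩

/-- The signed square of `z / √f`, and `0` if `f = 0`. For `z = a_jᵀ y` and `f = ‖a_j‖²` this is the
signed square of `â_jᵀ y`, so that minimizing it minimizes the cosine. -/
def score (z f : K) : Counted K := do
  let b ← isZero f
  if b then pure 0
  else do
    let p ← times z z
    let q ← divide p f
    let neg ← less z 0
    if neg then minus 0 q else pure q

/-- Find a column of least score together with its score, by one scan of the columns in the order
`σ 0, σ 1, …`. Among several columns of least score the one scanned first is taken. -/
def leastScore (σ : Equiv.Perm (Fin n)) (M : Memory K m n) : Counted (Option (Fin n × K)) :=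
  ((List.finRange n).map σ).foldlM (fun best j => do
    let c ← score (M.z j) (M.F j j)
    match best with
    | none => pure (some (j, c))
    | some (k, d) => do
      let b ← less c d
      pure (if b then some (j, c) else some (k, d))) none

/-- The update of `x` and `y` with column `k`. -/
def updateMemory (P : Matrix (Fin n) (Fin n) K) (M : Memory K m n) (k : Fin n) :
    Counted (Memory K m n) := do
  let c ← divide (M.z k) (M.F k k)
  let xk ← minus (M.x k) c
  let y ← table fun i => do
    let p ← times c (M.A i k)
    minus (M.y i) p
  let z ← table fun j => do
    let p ← times c (M.F j k)
    minus (M.z j) p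
  let xbar ← table fun j => do
    let p ← times c (P j k)
    minus (M.xbar j) p
  pure ⟨M.A, M.F, Function.update M.x k xk, y, z, xbar⟩

/-- The rescaling `A := (I + ŷ ŷᵀ) A`, `y := 2 y`, for `q = ‖y‖²`; accordingly
`F := F + 3 z zᵀ / q` and `z := 4 z`. -/
def rescaleMemory (M : Memory K m n) (q : K) : Counted (Memory K m n) := do
  let w ← table fun j => divide (M.z j) q
  let A ← tableMatrix fun i j => do
    let p ← times (M.y i) (w j)
    plus (M.A i j) p
  let F ← tableMatrix fun j l => do
    let p ← times (M.z j) (w l)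
    let r ← times 3 p
    plus (M.F j l) r
  let y ← table fun i => times 2 (M.y i)
  let z ← table fun j => times 4 (M.z j)
  pure ⟨A, F, M.x, y, z, M.xbar⟩

/-- One iteration of the while loop. The test `score < -‖y‖² / (11 m)²` is the test
`â_kᵀ ŷ < -1 / (11 m)`. -/
def iteration (σ : Equiv.Perm (Fin n)) (P : Matrix (Fin n) (Fin n) K) (M : Memory K m n) :
    Counted (Memory K m n) := do
  let best ← leastScore σ M
  match best with
  | none => pure M
  | some (k, c) => do
    let q ← inner M.y M.y
    let d ← times 11 (m : K)
    let e ← times d d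
    let r ← divide q e
    let t ← minus 0 r
    let b ← less c t
    if b then updateMemory P M k else rescaleMemory M q

/-- The while loop, cut off (without a result) when it has not stopped after `T` tests of the loop
condition. Iteration number `t` scans the columns in the order given by `σ t`. -/
def loop (P : Matrix (Fin n) (Fin n) K) (σ : ℕ → Equiv.Perm (Fin n)) :
    ℕ → ℕ → Memory K m n → Counted (Option (Fin n → K))
  | 0, _, _ => pure none
  | T + 1, t, M => do
    let b ← allPos M.xbar
    if b then pure (some M.xbar)
    else do
      let N ← iteration (σ t) P M
      loop P σ T (t + 1) N

/-- The Full Support Kernel Algorithm on input `A` as a program: it returns the vector `xbar`, or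
nothing if the loop condition has been tested `T` times without success. The sequence `σ` of
scanning orders only decides ties; every sequence of choices among minimizers comes from some
`σ`. -/
def kernelProgram (σ : ℕ → Equiv.Perm (Fin n)) (T : ℕ) (A : Matrix (Fin m) (Fin n) K) :
    Counted (Option (Fin n → K)) := do
  let P ← kernelProjection A
  let M ← prepare A P
  loop P σ T 0 M

end Program

end FullSupportKernel

/-! Write `V` for the normalized matrix, `L` for the encoding size, `R` and `U` for the numbers of
rescalings and updates so far.

Rescalings are bounded by a volume argument. Fix a basis of the image consisting of `r` columns of
`V`. Its Gram determinant is at least `4^(-L)`: before normalization it is a positive integer, and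
the product of the squared column norms is at most `4^L`. As `ŷ` lies in the image, each rescaling
multiplies this determinant by 4 (`Reach.det_eq`). Hadamard's inequality bounds it above by the
column norms, and these grow slowly. Since Goffin's measure is negative, each column occurs with
coefficient at least 1 in a nonnegative kernel vector `l` of total weight at most `4^L`
(`exists_nonneg_kernel_vector`). In `∑ l_j ‖a_j‖` the first order effect of a rescaling cancels
because `A l = 0`, so this sum grows by a factor of at most `1 + 2ε` (`weight_rescaling_le`). With
`(1 + 2ε)^(2m) ≤ 2` this gives `4^R ≤ 4^L · 2^R · 4^(2rL)`, hence `R ≤ 6 min(m,n) L`.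

Updates are bounded through `‖y‖²`, which starts at no more than `n²`, is multiplied by 4 in a
rescaling and by at most `1 - ε²` in an update. Before termination some entry of `Πx` is not
positive although `x ≥ 1`, so `‖x - Πx‖ ≥ 1`. This residual is the shortest vector with image `Vx`,
and a Cramer bound on a basic solution gives `1 ≤ n 4^L ‖Vx‖² ≤ n 4^L ‖y‖²`. Hence `U = O(m²
min(m,n) L)`.

A rescaling costs `O(n² + mn)` and an update `O(m + n)` operations. Estimating `min(m,n)` by `m` in
one term and by `n` in the other yields the claimed total. The program is tied to the algorithm by
the invariant `Represents`, with an operation count carried along in `loop_spec`. -/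

namespace FullSupportKernel

/-! ### Gram determinants: Hadamard's inequality and a Cramer bound. -/

section GramDeterminant

variable {m : ℕ} {ι : Type*} [Fintype ι] [DecidableEq ι]

theorem dotProduct_self_nonneg_real {κ : Type*} [Fintype κ] (v : κ → ℝ) : 0 ≤ v ⬝ᵥ v :=
  Finset.sum_nonneg fun i _ => mul_self_nonneg (v i)

theorem posSemidef_transpose_mul_self_real {κ : Type*} [Fintype κ] (B : Matrix (Fin m) κ ℝ) :
    (Bᵀ * B).PosSemidef := by
  simpa using Matrix.posSemidef_conjTranspose_mul_self B

theorem det_transpose_mul_self_pos {B : Matrix (Fin m) ι ℝ} (hB : LinearIndependent ℝ B.col) :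
    0 < (Bᵀ * B).det := by
  have := (Matrix.PosDef.conjTranspose_mul_self B (Matrix.mulVec_injective_iff.2 hB)).det_pos
  simpa using this

theorem det_transpose_mul_self_mul (B : Matrix (Fin m) ι ℝ) (E : Matrix ι ι ℝ) :
    ((B * E)ᵀ * (B * E)).det = E.det ^ 2 * (Bᵀ * B).det := by
  rw [Matrix.transpose_mul, Matrix.mul_assoc, ← Matrix.mul_assoc Bᵀ, Matrix.det_mul,
    Matrix.det_mul, Matrix.det_transpose]
  ring

/-- This is the inequality of arithmetic and geometric means for the eigenvalues, obtained by
multiplying the bounds `t ≤ exp (t - 1)`. -/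
theorem det_le_one_of_posSemidef_of_trace {G : Matrix ι ι ℝ} (hG : G.PosSemidef)
    (htr : G.trace = Fintype.card ι) : G.det ≤ 1 := by
  have hd := hG.1.det_eq_prod_eigenvalues
  have ht := hG.1.trace_eq_sum_eigenvalues
  simp only [RCLike.ofReal_real_eq_id, id] at hd ht
  rw [hd]
  calc ∏ i, hG.1.eigenvalues i ≤ ∏ i, Real.exp (hG.1.eigenvalues i - 1) :=
        Finset.prod_le_prod (fun i _ => hG.eigenvalues_nonneg i) fun i _ => by
          have := Real.add_one_le_exp (hG.1.eigenvalues i - 1)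
          linarith
    _ = 1 := by
        rw [← Real.exp_sum, Finset.sum_sub_distrib, ← ht, htr]
        simp

/-- Hadamard's inequality for Gram determinants. -/
theorem det_transpose_mul_self_le_prod (B : Matrix (Fin m) ι ℝ) :
    (Bᵀ * B).det ≤ ∏ i, B.col i ⬝ᵥ B.col i := by
  by_cases h0 : ∃ i, B.col i ⬝ᵥ B.col i = 0
  · obtain ⟨i, hi⟩ := h0
    have hz : B.col i = 0 := dotProduct_self_eq_zero.1 hi
    have : (Bᵀ * B).det = 0 := by
      refine Matrix.det_eq_zero_of_column_eq_zero i fun j => ?_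
      change B.col j ⬝ᵥ B.col i = 0
      rw [hz, dotProduct_zero]
    rw [this]
    exact Finset.prod_nonneg fun i _ => dotProduct_self_nonneg_real _
  · push Not at h0
    have hpos : ∀ i, 0 < B.col i ⬝ᵥ B.col i := fun i =>
      lt_of_le_of_ne (dotProduct_self_nonneg_real _) (h0 i).symm
    -- Scaling the columns to unit length makes the trace of the Gram matrix equal to its size.
    set D : Matrix ι ι ℝ := Matrix.diagonal fun i => (√(B.col i ⬝ᵥ B.col i))⁻¹ with hD
    have hdet : D.det ^ 2 = (∏ i, B.col i ⬝ᵥ B.col i)⁻¹ := by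
      rw [hD, Matrix.det_diagonal, ← Finset.prod_pow, ← Finset.prod_inv_distrib]
      refine Finset.prod_congr rfl fun i _ => ?_
      rw [inv_pow, Real.sq_sqrt (hpos i).le]
    have hone : ((B * D)ᵀ * (B * D)).det ≤ 1 := by
      refine det_le_one_of_posSemidef_of_trace (posSemidef_transpose_mul_self_real _) ?_
      have : ∀ i, ((B * D)ᵀ * (B * D)) i i = 1 := fun i => by
        have h1 : ((B * D)ᵀ * (B * D)) i i
            = (B.col i ⬝ᵥ B.col i) * (√(B.col i ⬝ᵥ B.col i))⁻¹ ^ 2 := by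
          rw [Matrix.mul_apply, dotProduct, Finset.sum_mul]
          simp only [Matrix.transpose_apply, hD, Matrix.mul_diagonal]
          exact Finset.sum_congr rfl fun k _ => by
            rw [Matrix.col_apply, mul_mul_mul_comm, sq]; rfl
        rw [h1, inv_pow, Real.sq_sqrt (hpos i).le, mul_inv_cancel₀ (h0 i)]
      rw [Matrix.trace, Finset.sum_congr rfl fun i _ => (Matrix.diag_apply _ i).trans (this i)]
      simp
    rw [det_transpose_mul_self_mul, hdet, inv_mul_le_iff₀ (Finset.prod_pos fun i _ => hpos i)]
      at hone
    simpa using hone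

/-- A Cramer type bound for the coefficients of a combination of vectors of norm at most one. -/
theorem det_mul_sq_le {B : Matrix (Fin m) ι ℝ} (hB : ∀ i, B.col i ⬝ᵥ B.col i ≤ 1) (c : ι → ℝ)
    (i : ι) : (Bᵀ * B).det * c i ^ 2 ≤ (B *ᵥ c) ⬝ᵥ (B *ᵥ c) := by
  -- As in Cramer's rule: `E` has determinant `c i`, and `B * E` is `B` with column `i` replaced by
  -- `B *ᵥ c`. Hadamard's inequality for `B * E` leaves only the norm of that column.
  set E : Matrix ι ι ℝ := (1 : Matrix ι ι ℝ).updateCol i c with hE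
  have hdet : E.det = c i := by
    rw [hE, ← Matrix.cramer_apply, Matrix.cramer_one]
    rfl
  have hcol : ∀ j, (B * E).col j = if j = i then B *ᵥ c else B.col j := fun j => by
    have : E.col j = if j = i then c else Pi.single j 1 := by
      ext k
      by_cases h : j = i
      · subst h; simp [hE]
      · simp [hE, h, Matrix.one_apply, Pi.single_apply]
    have h2 : (B * E).col j = B *ᵥ E.col j := by
      ext k; simp [Matrix.mul_apply, Matrix.mulVec, dotProduct]
    rw [h2, this]
    split_ifs with h
    · rfl
    · simp
  have := det_transpose_mul_self_le_prod (B * E)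
  rw [det_transpose_mul_self_mul, hdet] at this
  refine (mul_comm _ _).le.trans (this.trans ?_)
  rw [← Finset.mul_prod_erase _ _ (Finset.mem_univ i), hcol i, if_pos rfl]
  refine mul_le_of_le_one_right (dotProduct_self_nonneg_real _) ?_
  refine Finset.prod_le_one (fun j _ => dotProduct_self_nonneg_real _) fun j hj => ?_
  rw [hcol j, if_neg (Finset.ne_of_mem_erase hj)]
  exact hB j

end GramDeterminant

/-! ### Normalized vectors. -/

section Normalization

variable {m n : ℕ}

theorem enorm2_sq (v : Fin m → ℝ) : enorm2 v ^ 2 = v ⬝ᵥ v :=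
  Real.sq_sqrt (dotProduct_self_nonneg_real v)

theorem enorm2_nonneg (v : Fin m → ℝ) : 0 ≤ enorm2 v := Real.sqrt_nonneg _

theorem enorm2_eq_zero {v : Fin m → ℝ} : enorm2 v = 0 ↔ v = 0 := by
  rw [← sq_eq_zero_iff, enorm2_sq, dotProduct_self_eq_zero]

theorem enorm2_pos {v : Fin m → ℝ} : 0 < enorm2 v ↔ v ≠ 0 := by
  rw [(enorm2_nonneg v).lt_iff_ne, ne_comm, Ne, enorm2_eq_zero]

theorem hat_eq_smul (v : Fin m → ℝ) : hat v = (enorm2 v)⁻¹ • v := by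
  ext i
  simp [hat, div_eq_inv_mul]

theorem hat_zero : hat (0 : Fin m → ℝ) = 0 := by simp [hat_eq_smul]

theorem enorm2_smul_hat (v : Fin m → ℝ) : enorm2 v • hat v = v := by
  rcases eq_or_ne v 0 with rfl | hv
  · simp [hat_zero]
  · rw [hat_eq_smul, smul_smul, mul_inv_cancel₀ (enorm2_pos.2 hv).ne', one_smul]

theorem hat_dotProduct_self {v : Fin m → ℝ} (hv : v ≠ 0) : hat v ⬝ᵥ hat v = 1 := by
  have h := (enorm2_pos.2 hv).ne'
  rw [hat_eq_smul, smul_dotProduct, dotProduct_smul, ← enorm2_sq, smul_eq_mul, smul_eq_mul]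
  field_simp

theorem hat_dotProduct_self_le (v : Fin m → ℝ) : hat v ⬝ᵥ hat v ≤ 1 := by
  rcases eq_or_ne v 0 with rfl | hv
  · simp [hat_zero]
  · exact (hat_dotProduct_self hv).le

theorem enorm2_hat_le (v : Fin m → ℝ) : enorm2 (hat v) ≤ 1 :=
  Real.sqrt_le_one.2 (hat_dotProduct_self_le v)

theorem dotProduct_eq_enorm2_mul (v w : Fin m → ℝ) :
    v ⬝ᵥ w = enorm2 v * enorm2 w * (hat v ⬝ᵥ hat w) := by
  conv_lhs => rw [← enorm2_smul_hat v, ← enorm2_smul_hat w]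
  simp only [smul_dotProduct, dotProduct_smul, smul_eq_mul]
  ring

theorem dotProduct_sq_le {κ : Type*} [Fintype κ] (v w : κ → ℝ) :
    (v ⬝ᵥ w) ^ 2 ≤ (v ⬝ᵥ v) * (w ⬝ᵥ w) := by
  have := Finset.sum_mul_sq_le_sq_mul_sq Finset.univ v w
  simpa [dotProduct, pow_two] using this

theorem abs_hat_dotProduct_hat_le (v w : Fin m → ℝ) : |hat v ⬝ᵥ hat w| ≤ 1 := by
  rw [← sq_le_one_iff_abs_le_one]
  exact (dotProduct_sq_le _ _).trans (mul_le_one₀ (hat_dotProduct_self_le _)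
    (dotProduct_self_nonneg_real _) (hat_dotProduct_self_le _))

theorem hatMatrix_col (A : Matrix (Fin m) (Fin n) ℝ) (j : Fin n) :
    (hatMatrix A).col j = hat (A.col j) := rfl

theorem hatMatrix_eq_mul_diagonal (A : Matrix (Fin m) (Fin n) ℝ) :
    hatMatrix A = A * Matrix.diagonal fun j => (enorm2 (A.col j))⁻¹ := by
  ext i j
  simp [hatMatrix, hat, div_eq_mul_inv]

end Normalization

theorem one_add_sum_le_prod {κ : Type*} (s : Finset κ) {f : κ → ℝ} (hf : ∀ i, 0 ≤ f i) :
    1 + ∑ i ∈ s, f i ≤ ∏ i ∈ s, (1 + f i) := by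
  classical
  induction s using Finset.induction_on with
  | empty => simp
  | insert a s ha ih =>
    rw [Finset.sum_insert ha, Finset.prod_insert ha]
    nlinarith [hf a, Finset.sum_nonneg fun i (_ : i ∈ s) => hf i]

/-! ### Encoding size, column norms and integral Gram determinants. -/

section EncodingSize

variable {m n : ℕ} (A : Matrix (Fin m) (Fin n) ℤ)

theorem mul_le_encodingSize : m * n ≤ encodingSize A := by
  unfold encodingSize
  calc m * n = ∑ _i : Fin m, ∑ _j : Fin n, 1 := by simp
    _ ≤ _ := Finset.sum_le_sum fun i _ => Finset.sum_le_sum fun j _ => by omega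

theorem one_add_sq_le_four_pow_size (a : ℤ) :
    1 + (a : ℝ) ^ 2 ≤ 4 ^ (1 + Nat.size a.natAbs) := by
  have h := Nat.lt_size_self a.natAbs
  have h1 : ((a.natAbs : ℕ) : ℝ) ≤ 2 ^ Nat.size a.natAbs := by exact_mod_cast h.le
  have h2 : (a : ℝ) ^ 2 = ((a.natAbs : ℕ) : ℝ) ^ 2 := by
    rw [Nat.cast_natAbs, Int.cast_abs, sq_abs]
  have h3 : (4 : ℝ) ^ (1 + Nat.size a.natAbs) = 4 * (2 ^ Nat.size a.natAbs) ^ 2 := by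
    rw [pow_add, pow_one, ← pow_mul, mul_comm _ 2, pow_mul]
    norm_num
  have h4 : (1 : ℝ) ≤ 2 ^ Nat.size a.natAbs := one_le_pow₀ (by norm_num)
  rw [h2, h3]
  nlinarith [pow_le_pow_left₀ (Nat.cast_nonneg a.natAbs) h1 2, one_le_pow₀ h4 (n := 2)]

/-- The sum of squares is dominated by `∏ (1 + a²)`, which turns the sum of the entry sizes into an
exponent. -/
theorem dotProduct_col_le_four_pow (j : Fin n) :
    (A.map (Int.cast : ℤ → ℝ)).col j ⬝ᵥ (A.map (Int.cast : ℤ → ℝ)).col j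
      ≤ 4 ^ ∑ i, (1 + Nat.size (A i j).natAbs) := by
  rw [← Finset.prod_pow_eq_pow_sum]
  have h : (A.map (Int.cast : ℤ → ℝ)).col j ⬝ᵥ (A.map (Int.cast : ℤ → ℝ)).col j
      = ∑ i, ((A i j : ℤ) : ℝ) ^ 2 := by
    simp [dotProduct, pow_two]
  have h1 : (∑ i, ((A i j : ℤ) : ℝ) ^ 2) ≤ ∏ i, (1 + ((A i j : ℤ) : ℝ) ^ 2) := by
    have := one_add_sum_le_prod Finset.univ (f := fun i => ((A i j : ℤ) : ℝ) ^ 2)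
      fun i => sq_nonneg _
    linarith
  rw [h]
  exact h1.trans (Finset.prod_le_prod (fun i _ => by positivity)
    fun i _ => one_add_sq_le_four_pow_size _)

theorem prod_dotProduct_col_le {ι : Type*} [Fintype ι] {f : ι → Fin n}
    (hf : Function.Injective f) :
    ∏ k, (A.map (Int.cast : ℤ → ℝ)).col (f k) ⬝ᵥ (A.map (Int.cast : ℤ → ℝ)).col (f k)
      ≤ 4 ^ encodingSize A := by
  refine (Finset.prod_le_prod (fun k _ => dotProduct_self_nonneg_real _)
    fun k _ => dotProduct_col_le_four_pow A (f k)).trans ?_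
  rw [Finset.prod_pow_eq_pow_sum]
  refine pow_le_pow_right₀ (by norm_num) ?_
  unfold encodingSize
  rw [Finset.sum_comm (s := Finset.univ (α := Fin m))]
  calc ∑ k, ∑ i, (1 + Nat.size (A i (f k)).natAbs)
      = ∑ j ∈ Finset.univ.map ⟨f, hf⟩, ∑ i, (1 + Nat.size (A i j).natAbs) := by simp
    _ ≤ _ := Finset.sum_le_sum_of_subset (Finset.subset_univ _)

/-- The Gram determinant of linearly independent columns of the normalized matrix. -/
theorem one_le_four_pow_mul_det {ι : Type*} [Fintype ι] [DecidableEq ι] {f : ι → Fin n}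
    (hf : Function.Injective f)
    (hli : LinearIndependent ℝ ((hatMatrix (A.map (Int.cast : ℤ → ℝ))).submatrix id f).col) :
    1 ≤ 4 ^ encodingSize A *
      (((hatMatrix (A.map (Int.cast : ℤ → ℝ))).submatrix id f)ᵀ *
        ((hatMatrix (A.map (Int.cast : ℤ → ℝ))).submatrix id f)).det := by
  set R : Matrix (Fin m) (Fin n) ℝ := A.map (Int.cast : ℤ → ℝ) with hR
  set D : Matrix ι ι ℝ := Matrix.diagonal fun k => (enorm2 (R.col (f k)))⁻¹ with hD
  have hfac : (hatMatrix R).submatrix id f = R.submatrix id f * D := by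
    ext i j
    simp [hatMatrix, hat, div_eq_mul_inv, hD]
  have hpos := det_transpose_mul_self_pos hli
  rw [hfac, det_transpose_mul_self_mul] at hpos ⊢
  -- Before normalization the Gram determinant is an integer; being positive, it is at least 1.
  have hint : ∃ d : ℤ, ((R.submatrix id f)ᵀ * R.submatrix id f).det = d := by
    refine ⟨((A.submatrix id f)ᵀ * A.submatrix id f).det, ?_⟩
    change _ = Int.castRingHom ℝ _
    rw [ RingHom.map_det, RingHom.mapMatrix_apply, Matrix.map_mul]
    rfl
  obtain ⟨d, hd⟩ := hint
  rw [hd] at hpos ⊢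
  have hd1 : (1 : ℝ) ≤ d := by
    have : (0 : ℝ) < d := pos_of_mul_pos_right hpos (sq_nonneg _)
    exact_mod_cast this
  have hDdet : D.det ^ 2 = (∏ k, R.col (f k) ⬝ᵥ R.col (f k))⁻¹ := by
    rw [hD, Matrix.det_diagonal, ← Finset.prod_pow, ← Finset.prod_inv_distrib]
    exact Finset.prod_congr rfl fun k _ => by rw [inv_pow, enorm2_sq]
  rw [hDdet] at hpos ⊢
  have hP : 0 < ∏ k, R.col (f k) ⬝ᵥ R.col (f k) := by
    have : 0 < (∏ k, R.col (f k) ⬝ᵥ R.col (f k))⁻¹ := pos_of_mul_pos_left hpos (by linarith)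
    exact inv_pos.1 this
  have hle := prod_dotProduct_col_le A hf
  rw [← mul_assoc, ← div_eq_mul_inv]
  have : 1 ≤ 4 ^ encodingSize A / ∏ k, R.col (f k) ⬝ᵥ R.col (f k) := (one_le_div hP).2 hle
  nlinarith

end EncodingSize

/-! ### Conic combinations of columns. -/

section Cone

variable {m n : ℕ}

theorem submatrix_mulVec_comp {ι : Type*} [Fintype ι] (V : Matrix (Fin m) (Fin n) ℝ)
    {f : ι → Fin n} (hf : Function.Injective f) {c : Fin n → ℝ}
    (hc : ∀ j, j ∉ Set.range f → c j = 0) :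
    V.submatrix id f *ᵥ (c ∘ f) = V *ᵥ c := by
  ext i
  simp only [Matrix.mulVec, dotProduct, Matrix.submatrix_apply, id, Function.comp]
  exact Fintype.sum_of_injective f hf _ _ (fun j hj => by rw [hc j hj, mul_zero]) fun _ => rfl

/-- Carathéodory's theorem for cones. -/
theorem exists_nonneg_linearIndependent_support (V : Matrix (Fin m) (Fin n) ℝ) {c : Fin n → ℝ}
    (hc : ∀ j, 0 ≤ c j) :
    ∃ d : Fin n → ℝ, (∀ j, 0 ≤ d j) ∧ V *ᵥ d = V *ᵥ c ∧
      LinearIndependent ℝ (fun j : {j // d j ≠ 0} => V.col j) := by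
  classical
  induction h : (Finset.univ.filter fun j => c j ≠ 0).card using Nat.strong_induction_on
    generalizing c with
  | _ N ih =>
  by_cases hli : LinearIndependent ℝ (fun j : {j // c j ≠ 0} => V.col j)
  · exact ⟨c, hc, rfl, hli⟩
  obtain ⟨g, hg, j₀, hj₀⟩ := Fintype.not_linearIndependent_iff.1 hli
  obtain ⟨g, hg, j₀, hj₀⟩ : ∃ g : {j // c j ≠ 0} → ℝ, ∑ j, g j • V.col j = 0 ∧ ∃ j, 0 < g j := by
    rcases lt_or_gt_of_ne hj₀ with h | h
    · refine ⟨fun j => - g j, ?_, j₀, by simpa using h⟩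
      simpa using hg
    · exact ⟨g, hg, j₀, h⟩
  set e : Fin n → ℝ := fun j => if h : c j ≠ 0 then g ⟨j, h⟩ else 0 with he
  have hesub : ∀ j : {j // c j ≠ 0}, e j = g j := fun j => by simp [he, j.2]
  have he0 : ∀ j, c j = 0 → e j = 0 := fun j hj => by simp [he, hj]
  have hVe : V *ᵥ e = 0 := by
    rw [← submatrix_mulVec_comp V (f := ((↑) : {j // c j ≠ 0} → Fin n))
      Subtype.val_injective (fun j hj => he0 j (by simpa using hj)), ← hg]
    ext i
    simp [Matrix.mulVec, dotProduct, hesub, mul_comm]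
  have hne : (Finset.univ.filter fun j => 0 < e j).Nonempty :=
    ⟨j₀, by simpa [hesub] using hj₀⟩
  -- Ratio test: moving from `c` against the relation `e`, the coefficient at the minimizing `k` is
  -- the first to vanish, so the support shrinks while all coefficients stay nonnegative.
  obtain ⟨k, hk, hmin⟩ := Finset.exists_min_image _ (fun j => c j / e j) hne
  have hk' : 0 < e k := by simpa using hk
  have hck : c k ≠ 0 := fun h => hk'.ne' (he0 k h)
  have hVd : V *ᵥ (c - (c k / e k) • e) = V *ᵥ c := by
    rw [Matrix.mulVec_sub, Matrix.mulVec_smul, hVe, smul_zero, sub_zero]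
  have hd : ∀ j, 0 ≤ (c - (c k / e k) • e) j := fun j => by
    have hq : 0 ≤ c k / e k := div_nonneg (hc k) hk'.le
    simp only [Pi.sub_apply, Pi.smul_apply, smul_eq_mul, sub_nonneg]
    rcases lt_or_ge 0 (e j) with h | h
    · exact (le_div_iff₀ h).1 (hmin j (by simpa using h))
    · exact (mul_nonpos_of_nonneg_of_nonpos hq h).trans (hc j)
  have hcard : (Finset.univ.filter fun j => (c - (c k / e k) • e) j ≠ 0).card < N := by
    rw [← h]
    refine Finset.card_lt_card (Finset.ssubset_iff_of_subset (fun j => ?_) |>.2 ⟨k, ?_, ?_⟩)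
    · simp only [Finset.mem_filter, Finset.mem_univ, true_and]
      intro h1 h2
      exact h1 (by simp [h2, he0 j h2])
    · simpa using hck
    · simp [hk'.ne']
  obtain ⟨d, h1, h2, h3⟩ := ih _ hcard hd rfl
  exact ⟨d, h1, h2.trans hVd, h3⟩

/-- The normal equations are solvable because `Aᵀ * A` and `Aᵀ` have the same rank. This replaces
`v` by a vector of the image with the same inner products with all columns. -/
theorem exists_mulVec_transpose_mulVec (A : Matrix (Fin m) (Fin n) ℝ) (v : Fin m → ℝ) :
    ∃ s, Aᵀ *ᵥ (A *ᵥ s) = Aᵀ *ᵥ v := by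
  have hle : LinearMap.range (Aᵀ * A).mulVecLin ≤ LinearMap.range Aᵀ.mulVecLin := by
    rintro _ ⟨s, rfl⟩
    exact ⟨A *ᵥ s, by simp only [Matrix.mulVecLin_apply, Matrix.mulVec_mulVec]⟩
  have heq := Submodule.eq_of_le_of_finrank_eq hle (by
    change (Aᵀ * A).rank = Aᵀ.rank
    rw [Matrix.rank_transpose_mul_self, Matrix.rank_transpose])
  obtain ⟨s, hs⟩ : Aᵀ *ᵥ v ∈ LinearMap.range (Aᵀ * A).mulVecLin := heq ▸ ⟨v, rfl⟩
  exact ⟨s, by simpa only [Matrix.mulVecLin_apply, Matrix.mulVec_mulVec] using hs⟩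

theorem range_hatMatrix_mulVec_subset (A : Matrix (Fin m) (Fin n) ℝ) (s : Fin n → ℝ) :
    hatMatrix A *ᵥ s ∈ Set.range A.mulVec := by
  rw [hatMatrix_eq_mul_diagonal, ← Matrix.mulVec_mulVec]
  exact ⟨_, rfl⟩

/-- If Goffin's measure is negative, the columns positively span the image. -/
theorem exists_nonneg_mulVec_eq_neg_hat {A : Matrix (Fin m) (Fin n) ℝ} (hA : goffin A < 0)
    (k : Fin n) : ∃ c : Fin n → ℝ, (∀ j, 0 ≤ c j) ∧ hatMatrix A *ᵥ c = - hat (A.col k) := by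
  -- A real `q` strictly between Goffin's measure and 0 leaves room: the multiple `q • â_k` will be
  -- shown to lie in the convex hull of the columns, and division by `-q` gives the claim.
  obtain ⟨q, hq, hq0⟩ := EReal.lt_iff_exists_real_btwn.1 hA
  have hq0 : q < 0 := by exact_mod_cast hq0
  set V := hatMatrix A with hV
  set w : Fin m → ℝ := q • hat (A.col k) with hw
  suffices hmem : w ∈ convexHull ℝ (Set.range V.col) by
    have hsub : convexHull ℝ (Set.range V.col) ⊆ {x | ∃ c, (∀ j, 0 ≤ c j) ∧ V *ᵥ c = x} := by
      refine convexHull_min ?_ ?_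
      · rintro _ ⟨j, rfl⟩
        refine ⟨Pi.single j 1, fun i => ?_, by simp⟩
        rcases eq_or_ne i j with rfl | h <;> simp [*]
      · rintro _ ⟨c, hc, rfl⟩ _ ⟨d, hd, rfl⟩ a b ha hb -
        refine ⟨a • c + b • d, fun j => ?_, by simp [Matrix.mulVec_add, Matrix.mulVec_smul]⟩
        exact add_nonneg (mul_nonneg ha (hc j)) (mul_nonneg hb (hd j))
    obtain ⟨c, hc, hVc⟩ := hsub hmem
    refine ⟨(-q⁻¹) • c, fun j => mul_nonneg ?_ (hc j), ?_⟩
    · exact neg_nonneg.2 (inv_nonpos.2 hq0.le)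
    · rw [Matrix.mulVec_smul, hVc, hw, smul_smul, neg_mul, inv_mul_cancel₀ hq0.ne, neg_smul,
        one_smul]
  by_contra hmem
  obtain ⟨φ, u, h1, h2⟩ := geometric_hahn_banach_point_closed (convex_convexHull ℝ _)
    ((Set.finite_range V.col).isClosed_convexHull ℝ) hmem
  obtain ⟨v, hv⟩ : ∃ v : Fin m → ℝ, ∀ x, φ x = v ⬝ᵥ x := by
    refine ⟨fun i => φ (Pi.single i 1), fun x => ?_⟩
    have := LinearMap.pi_apply_eq_sum_univ φ.toLinearMap x
    simp only [ContinuousLinearMap.coe_coe, smul_eq_mul] at this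
    rw [this, dotProduct]
    refine Finset.sum_congr rfl fun i _ => ?_
    rw [mul_comm]
    congr 2
    ext j
    simp [Pi.single_apply, eq_comm]
  -- The separating vector `v` need not lie in the image, where Goffin's measure applies; `V *ᵥ s`
  -- does and separates equally well. Some column then has cosine below `q` with it, while `w = q •
  -- â_k` has inner product at least `q ‖V *ᵥ s‖`, against the separation.
  obtain ⟨s, hs⟩ := exists_mulVec_transpose_mulVec V v
  have hcol : ∀ j, v ⬝ᵥ V.col j = (V *ᵥ s) ⬝ᵥ V.col j := fun j => by
    have := congrFun hs j
    rw [dotProduct_comm v, dotProduct_comm (V *ᵥ s)]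
    exact this.symm
  have hlt : ∀ j, (V *ᵥ s) ⬝ᵥ w < (V *ᵥ s) ⬝ᵥ V.col j := fun j => by
    have h3 := h2 _ (subset_convexHull ℝ _ ⟨j, rfl⟩)
    rw [hv] at h1 h3
    rw [← hcol j]
    have : (V *ᵥ s) ⬝ᵥ w = v ⬝ᵥ w := by
      rw [hw, dotProduct_smul, dotProduct_smul, ← hatMatrix_col, ← hV, hcol k]
    linarith
  have hne : V *ᵥ s ≠ 0 := fun h => by
    have := hlt k
    simp [h] at this
  have hinf : (⨅ j : Fin n, ((hat (A.col j) ⬝ᵥ hat (V *ᵥ s) : ℝ) : EReal)) < q :=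
    lt_of_le_of_lt (le_iSup₂_of_le (V *ᵥ s) ⟨range_hatMatrix_mulVec_subset A s, hne⟩ le_rfl) hq
  obtain ⟨j, hj⟩ := iInf_lt_iff.1 hinf
  have hj : hat (A.col j) ⬝ᵥ hat (V *ᵥ s) < q := by exact_mod_cast hj
  have hpos := enorm2_pos.2 hne
  have h4 : (V *ᵥ s) ⬝ᵥ V.col j < enorm2 (V *ᵥ s) * q := by
    calc (V *ᵥ s) ⬝ᵥ V.col j = enorm2 (V *ᵥ s) * (hat (A.col j) ⬝ᵥ hat (V *ᵥ s)) := by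
          conv_lhs => rw [← enorm2_smul_hat (V *ᵥ s)]
          rw [smul_dotProduct, dotProduct_comm, smul_eq_mul, hV, hatMatrix_col]
      _ < _ := mul_lt_mul_of_pos_left hj hpos
  have h5 : enorm2 (V *ᵥ s) * q ≤ (V *ᵥ s) ⬝ᵥ w := by
    have h6 : (V *ᵥ s) ⬝ᵥ w = enorm2 (V *ᵥ s) * (q * (hat (A.col k) ⬝ᵥ hat (V *ᵥ s))) := by
      conv_lhs => rw [← enorm2_smul_hat (V *ᵥ s)]
      rw [smul_dotProduct, hw, dotProduct_smul, dotProduct_comm, smul_eq_mul, smul_eq_mul]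
    rw [h6]
    have := (abs_le.1 (abs_hat_dotProduct_hat_le (A.col k) (V *ᵥ s))).2
    exact mul_le_mul_of_nonneg_left (by nlinarith) hpos.le
  exact absurd (hlt j) (by linarith)

end Cone

/-! ### Coefficient bounds from integrality. -/

section Integer

variable {m n : ℕ} (A : Matrix (Fin m) (Fin n) ℤ)

theorem sq_le_of_linearIndependent {ι : Type*} [Fintype ι] [DecidableEq ι] {f : ι → Fin n}
    (hf : Function.Injective f)
    (hli : LinearIndependent ℝ ((hatMatrix (A.map (Int.cast : ℤ → ℝ))).submatrix id f).col)
    (c : ι → ℝ) (i : ι) :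
    c i ^ 2 ≤ 4 ^ encodingSize A *
      (((hatMatrix (A.map (Int.cast : ℤ → ℝ))).submatrix id f *ᵥ c) ⬝ᵥ
        ((hatMatrix (A.map (Int.cast : ℤ → ℝ))).submatrix id f *ᵥ c)) := by
  have h1 := one_le_four_pow_mul_det A hf hli
  have h2 := det_mul_sq_le (B := (hatMatrix (A.map (Int.cast : ℤ → ℝ))).submatrix id f)
    (fun i => hat_dotProduct_self_le _) c i
  calc c i ^ 2 ≤ (4 ^ encodingSize A * _) * c i ^ 2 := le_mul_of_one_le_left (sq_nonneg _) h1
    _ = 4 ^ encodingSize A * (_ * c i ^ 2) := mul_assoc _ _ _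
    _ ≤ _ := mul_le_mul_of_nonneg_left h2 (by positivity)

/-- Add the unit vector of `k` to a conic representation of `-â_k`. By Carathéodory its support may
be taken independent, so the Cramer bound limits every coefficient to `2^L`. -/
theorem exists_nonneg_kernel_vector (hA : goffin (A.map (Int.cast : ℤ → ℝ)) < 0) (k : Fin n)
    (hm : 0 < m) :
    ∃ l : Fin n → ℝ, (∀ j, 0 ≤ l j) ∧ hatMatrix (A.map (Int.cast : ℤ → ℝ)) *ᵥ l = 0 ∧ 1 ≤ l k ∧
      ∑ j, l j ≤ 4 ^ encodingSize A := by
  classical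
  set V := hatMatrix (A.map (Int.cast : ℤ → ℝ)) with hV
  obtain ⟨c, hc, hVc⟩ := exists_nonneg_mulVec_eq_neg_hat hA k
  obtain ⟨d, hd, hVd, hli⟩ := exists_nonneg_linearIndependent_support V hc
  rw [hVc] at hVd
  have hle : ∀ j, d j ≤ 2 ^ encodingSize A := fun j => by
    by_cases hj : d j = 0
    · rw [hj]; positivity
    have h := sq_le_of_linearIndependent A (f := ((↑) : {j // d j ≠ 0} → Fin n))
      Subtype.val_injective hli (d ∘ (↑)) ⟨j, hj⟩
    rw [← hV, submatrix_mulVec_comp V Subtype.val_injective (fun j hj => by simpa using hj), hVd,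
      neg_dotProduct, dotProduct_neg, neg_neg] at h
    have h1 : d j ^ 2 ≤ (2 ^ encodingSize A) ^ 2 := by
      refine h.trans ?_
      rw [← pow_mul, mul_comm _ 2, pow_mul]
      norm_num
      exact hat_dotProduct_self_le _
    exact (pow_le_pow_iff_left₀ (hd j) (by positivity) two_ne_zero).1 h1
  refine ⟨d + Pi.single k 1, fun j => add_nonneg (hd j) ?_, ?_, ?_, ?_⟩
  · rcases eq_or_ne j k with rfl | h <;> simp [*]
  · rw [Matrix.mulVec_add, hVd, Matrix.mulVec_single_one, hV, hatMatrix_col, neg_add_cancel]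
  · simpa using hd k
  -- The total is at most `n 2^L + 1 ≤ (n + 1) 2^L ≤ 4^L`, using `n ≤ L < 2^L`.
  · have hn : n ≤ encodingSize A := (Nat.le_mul_of_pos_left n hm).trans (mul_le_encodingSize A)
    have hL : encodingSize A + 1 ≤ 2 ^ encodingSize A := Nat.lt_two_pow_self
    have hL' : (n : ℝ) + 1 ≤ 2 ^ encodingSize A := by
      exact_mod_cast (Nat.add_le_add_right hn 1).trans hL
    have h1 : ∑ j, d j ≤ n * 2 ^ encodingSize A := by
      simpa using Finset.sum_le_card_nsmul Finset.univ d _ fun j _ => hle j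
    have h2 : (4 : ℝ) ^ encodingSize A = 2 ^ encodingSize A * 2 ^ encodingSize A := by
      rw [← mul_pow]; norm_num
    have h3 : (1 : ℝ) ≤ 2 ^ encodingSize A := one_le_pow₀ (by norm_num)
    simp only [Pi.add_apply, Finset.sum_add_distrib, Finset.sum_pi_single', Finset.mem_univ,
      if_true, h2]
    simp
    nlinarith

end Integer

/-! ### A basis of the image among the columns. -/

section Columns

variable {m n : ℕ}

/-- Finitely many linearly independent columns span the image. -/
theorem exists_column_basis (V : Matrix (Fin m) (Fin n) ℝ) :
    ∃ (r : ℕ) (f : Fin r → Fin n) (D : Matrix (Fin r) (Fin n) ℝ), Function.Injective f ∧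
      LinearIndependent ℝ (V.submatrix id f).col ∧ V = V.submatrix id f * D ∧ r ≤ m ∧ r ≤ n := by
  obtain ⟨κ, a, ha, hspan, hli⟩ := exists_linearIndependent' ℝ V.col
  have : Finite κ := Finite.of_injective a ha
  obtain ⟨r, ⟨e⟩⟩ := Finite.exists_equiv_fin κ
  have hrange : Set.range (V.col ∘ (a ∘ e.symm)) = Set.range (V.col ∘ a) := by
    rw [← Function.comp_assoc, e.symm.surjective.range_comp]
  have hli' : LinearIndependent ℝ (V.col ∘ (a ∘ e.symm)) := hli.comp _ e.symm.injective
  have hmem : ∀ j, ∃ d : Fin r → ℝ, ∑ i, d i • V.col (a (e.symm i)) = V.col j := fun j => by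
    have h : V.col j ∈ Submodule.span ℝ (Set.range (V.col ∘ (a ∘ e.symm))) := by
      rw [hrange, hspan]
      exact Submodule.subset_span ⟨j, rfl⟩
    exact (Submodule.mem_span_range_iff_exists_fun ℝ).1 h
  choose d hd using hmem
  refine ⟨r, a ∘ e.symm, Matrix.of fun i j => d j i, ha.comp e.symm.injective, hli', ?_, ?_, ?_⟩
  · ext i j
    have := congrFun (hd j) i
    simp only [Finset.sum_apply, Pi.smul_apply, smul_eq_mul, Matrix.col_apply] at this
    rw [← this]
    simp [Matrix.mul_apply, mul_comm]
  · simpa using hli'.fintype_card_le_finrank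
  · simpa using Fintype.card_le_of_injective _ (ha.comp e.symm.injective)

end Columns

/-! ### The orthogonal projection to the kernel. -/

section Projection

variable {m n : ℕ} (V : Matrix (Fin m) (Fin n) ℝ)

theorem mulVec_projKer (x : Fin n → ℝ) : V *ᵥ projKer V x = 0 := by
  have h := (LinearMap.ker (Matrix.toEuclideanLin V)).starProjection_apply_mem (WithLp.toLp 2 x)
  rw [LinearMap.mem_ker] at h
  have := congrArg WithLp.ofLp h
  simpa [projKer, Matrix.toLpLin_apply] using this

theorem sub_projKer_dotProduct (x : Fin n → ℝ) {u : Fin n → ℝ} (hu : V *ᵥ u = 0) :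
    (x - projKer V x) ⬝ᵥ u = 0 := by
  have h := (LinearMap.ker (Matrix.toEuclideanLin V)).starProjection_inner_eq_zero
    (WithLp.toLp 2 x) (WithLp.toLp 2 u) (by
      rw [LinearMap.mem_ker]
      simp [hu])
  rw [EuclideanSpace.inner_eq_star_dotProduct] at h
  rw [dotProduct_comm]
  simpa [projKer] using h

theorem eq_projKer {x p : Fin n → ℝ} (hp : V *ᵥ p = 0)
    (h : ∀ u, V *ᵥ u = 0 → (x - p) ⬝ᵥ u = 0) : p = projKer V x := by
  have h0 : V *ᵥ (p - projKer V x) = 0 := by rw [Matrix.mulVec_sub, hp, mulVec_projKer, sub_zero]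
  have h1 := h _ h0
  have h2 := sub_projKer_dotProduct V x h0
  have h3 : (p - projKer V x) ⬝ᵥ (p - projKer V x) = 0 := by
    have : p - projKer V x = (x - projKer V x) - (x - p) := by abel
    conv_lhs => rw [this, sub_dotProduct]
    rw [← this, h1, h2, sub_zero]
  exact sub_eq_zero.1 (dotProduct_self_eq_zero.1 h3)

theorem projKer_eq_self {x : Fin n → ℝ} (hx : V *ᵥ x = 0) : projKer V x = x :=
  (eq_projKer V hx fun u _ => by simp).symm

/-- Pythagoras: `c` differs from `x - Πx` by a kernel vector, to which `x - Πx` is orthogonal. -/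
theorem sub_projKer_sq_le {x c : Fin n → ℝ} (hc : V *ᵥ c = V *ᵥ x) :
    (x - projKer V x) ⬝ᵥ (x - projKer V x) ≤ c ⬝ᵥ c := by
  have h0 : V *ᵥ (c - (x - projKer V x)) = 0 := by
    rw [Matrix.mulVec_sub, Matrix.mulVec_sub, mulVec_projKer, hc, sub_zero, sub_self]
  have h1 := sub_projKer_dotProduct V x h0
  have h2 : c = (x - projKer V x) + (c - (x - projKer V x)) := by abel
  set p := x - projKer V x
  set d := c - p
  have : c ⬝ᵥ c = p ⬝ᵥ p + d ⬝ᵥ d := by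
    rw [h2]
    simp only [add_dotProduct, dotProduct_add]
    rw [dotProduct_comm d p, h1]
    ring
  rw [this]
  linarith [dotProduct_self_nonneg_real d]

end Projection

/-- As long as the projection is not positive, the image of `x ≥ 1` is bounded away from `0`. -/
theorem one_le_mul_of_not_projKer_pos {m n : ℕ} (A : Matrix (Fin m) (Fin n) ℤ)
    {x : Fin n → ℝ} (hx : ∀ j, 1 ≤ x j)
    (h : ¬ ∀ j, 0 < projKer (hatMatrix (A.map (Int.cast : ℤ → ℝ))) x j) :
    1 ≤ n * 4 ^ encodingSize A * ((hatMatrix (A.map (Int.cast : ℤ → ℝ)) *ᵥ x) ⬝ᵥ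
      (hatMatrix (A.map (Int.cast : ℤ → ℝ)) *ᵥ x)) := by
  set V := hatMatrix (A.map (Int.cast : ℤ → ℝ)) with hV
  push Not at h
  obtain ⟨j, hj⟩ := h
  obtain ⟨r, f, D, hf, hli, hD, -, hrn⟩ := exists_column_basis V
  -- The basic solution: coefficients of `V *ᵥ x` in the column basis, extended by zero. Its entries
  -- obey the Cramer bound.
  set c : Fin n → ℝ := Function.extend f (D *ᵥ x) 0 with hc
  have hcf : c ∘ f = D *ᵥ x := by
    ext i; simp [hc, hf.extend_apply]
  have hc0 : ∀ j, j ∉ Set.range f → c j = 0 := fun j hj => by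
    rw [hc, Function.extend_apply' _ _ _ (by simpa using hj)]; rfl
  have hVc' : V.submatrix id f *ᵥ (D *ᵥ x) = V *ᵥ x := by
    rw [Matrix.mulVec_mulVec, ← hD]
  have hVc : V *ᵥ c = V *ᵥ x := by
    rw [← submatrix_mulVec_comp V hf hc0, hcf, hVc']
  have h1 := sub_projKer_sq_le V hVc
  have h2 : 1 ≤ (x - projKer V x) ⬝ᵥ (x - projKer V x) := by
    have h3 : 1 ≤ (x - projKer V x) j := by simpa using by linarith [hx j]
    calc (1 : ℝ) ≤ (x - projKer V x) j * (x - projKer V x) j := by nlinarith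
      _ ≤ _ := Finset.single_le_sum (f := fun j => (x - projKer V x) j * (x - projKer V x) j)
        (fun i _ => mul_self_nonneg _) (Finset.mem_univ j)
  have h3 : c ⬝ᵥ c ≤ n * (4 ^ encodingSize A * ((V *ᵥ x) ⬝ᵥ (V *ᵥ x))) := by
    rw [dotProduct]
    have : ∀ j ∈ Finset.univ, c j * c j ≤ 4 ^ encodingSize A * ((V *ᵥ x) ⬝ᵥ (V *ᵥ x)) :=
        fun j _ => by
      by_cases hj : j ∈ Set.range f
      · obtain ⟨i, rfl⟩ := hj
        have := sq_le_of_linearIndependent A hf hli (D *ᵥ x) i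
        rw [← hV, hVc', ← hcf] at this
        simpa [pow_two] using this
      · rw [hc0 j hj, mul_zero]
        exact mul_nonneg (by positivity) (dotProduct_self_nonneg_real _)
    simpa using Finset.sum_le_card_nsmul Finset.univ _ _ this
  linarith

/-! ### Runs of the algorithm and the effect of a single step. -/

variable {m n : ℕ}

/-- The state after the update with column `k`. -/
noncomputable def State.update (s : State m n) (k : Fin n) : State m n :=
  ⟨s.A, s.x - ((s.A.col k ⬝ᵥ s.y) / enorm2 (s.A.col k) ^ 2) • Pi.single k (1 : ℝ),
    s.y - (hat (s.A.col k) ⬝ᵥ s.y) • hat (s.A.col k)⟩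

/-- The state after a rescaling. -/
noncomputable def State.rescale (s : State m n) : State m n :=
  ⟨(1 + Matrix.vecMulVec (hat s.y) (hat s.y)) * s.A, s.x, (2 : ℝ) • s.y⟩

/-- The states that are reached after `R` rescalings and `U` updates. -/
inductive Reach (A₀ : Matrix (Fin m) (Fin n) ℝ) : ℕ → ℕ → State m n → Prop
  | start : Reach A₀ 0 0 (start A₀)
  | update {R U : ℕ} {s : State m n} (k : Fin n) (h : Reach A₀ R U s) (hs : ¬ Stops A₀ s)
      (hk : s.IsArgmin k) (hc : s.cosine k < -eps m) : Reach A₀ R (U + 1) (s.update k)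
  | rescale {R U : ℕ} {s : State m n} (k : Fin n) (h : Reach A₀ R U s) (hs : ¬ Stops A₀ s)
      (hk : s.IsArgmin k) (hc : ¬ s.cosine k < -eps m) : Reach A₀ (R + 1) U s.rescale

theorem eps_nonneg (m : ℕ) : 0 ≤ eps m := by unfold eps; positivity

section Rescaling

theorem rescaling_mulVec (w v : Fin m → ℝ) :
    (1 + Matrix.vecMulVec w w) *ᵥ v = v + (w ⬝ᵥ v) • w := by
  rw [Matrix.add_mulVec, Matrix.one_mulVec, Matrix.vecMulVec_mulVec]
  simp

theorem rescaling_mul_col (w : Fin m → ℝ) (A : Matrix (Fin m) (Fin n) ℝ) (j : Fin n) :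
    ((1 + Matrix.vecMulVec w w) * A).col j = A.col j + (w ⬝ᵥ A.col j) • w := by
  rw [← rescaling_mulVec]
  ext i
  simp [Matrix.mul_apply, Matrix.mulVec, dotProduct]

theorem rescaling_dotProduct_self {w : Fin m → ℝ} (hw : w ⬝ᵥ w = 1) (v : Fin m → ℝ) :
    (v + (w ⬝ᵥ v) • w) ⬝ᵥ (v + (w ⬝ᵥ v) • w) = v ⬝ᵥ v + 3 * (w ⬝ᵥ v) ^ 2 := by
  simp only [add_dotProduct, dotProduct_add, smul_dotProduct, dotProduct_smul, smul_eq_mul, hw]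
  rw [dotProduct_comm v w]
  ring

/-- With `t` the cosine, the squared norm grows by the factor `1 + 3t²`, which is at most `(1 +
|t|)²` since `|t| ≤ 1`. -/
theorem enorm2_rescaling_le {w : Fin m → ℝ} (hw : w ⬝ᵥ w = 1) (v : Fin m → ℝ) :
    enorm2 (v + (w ⬝ᵥ v) • w) ≤ enorm2 v * (1 + |hat v ⬝ᵥ w|) := by
  refine Real.sqrt_le_iff.2 ⟨mul_nonneg (enorm2_nonneg v) (by positivity), ?_⟩
  have h1 : w ⬝ᵥ v = enorm2 v * (hat v ⬝ᵥ w) := by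
    conv_lhs => rw [← enorm2_smul_hat v]
    rw [dotProduct_smul, dotProduct_comm, smul_eq_mul]
  have h2 : |hat v ⬝ᵥ w| ≤ 1 := by
    rw [← sq_le_one_iff_abs_le_one]
    refine (dotProduct_sq_le _ _).trans ?_
    rw [hw, mul_one]
    exact hat_dotProduct_self_le v
  rw [rescaling_dotProduct_self hw, h1, mul_pow, mul_pow, ← enorm2_sq, ← sq_abs (hat v ⬝ᵥ w)]
  have h3 := abs_nonneg (hat v ⬝ᵥ w)
  nlinarith [mul_nonneg (sq_nonneg (enorm2 v)) (mul_nonneg h3 (sub_nonneg.2 h2))]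

/-- Rescaling in a direction in the column span multiplies the Gram determinant by `4`. -/
theorem det_rescaling {ι : Type*} [Fintype ι] [DecidableEq ι] (B : Matrix (Fin m) ι ℝ)
    {w : Fin m → ℝ} (hw : w ⬝ᵥ w = 1) {c : ι → ℝ} (hc : B *ᵥ c = w) :
    (((1 + Matrix.vecMulVec w w) * B)ᵀ * ((1 + Matrix.vecMulVec w w) * B)).det
      = 4 * (Bᵀ * B).det := by
  -- Because `w = B *ᵥ c`, the rescaling acts on `B` as a square matrix from the right, of
  -- determinant `1 + w ⬝ᵥ w = 2`.
  have h : (1 + Matrix.vecMulVec w w) * B = B * (1 + Matrix.vecMulVec c (w ᵥ* B)) := by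
    rw [Matrix.add_mul, Matrix.mul_add, Matrix.one_mul, Matrix.mul_one, Matrix.mul_vecMulVec, hc,
      Matrix.vecMulVec_mul]
  have hd : (1 + Matrix.vecMulVec c (w ᵥ* B)).det = 2 := by
    rw [Matrix.vecMulVec_eq Unit, Matrix.det_one_add_replicateCol_mul_replicateRow,
      ← Matrix.dotProduct_mulVec, hc, hw]
    norm_num
  rw [h, det_transpose_mul_self_mul, hd]
  norm_num

/-- Rescaling hardly increases the weight of a nonnegative linear relation between columns. -/
theorem weight_rescaling_le {A : Matrix (Fin m) (Fin n) ℝ} {l : Fin n → ℝ} (hl : ∀ j, 0 ≤ l j)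
    (hAl : A *ᵥ l = 0) {w : Fin m → ℝ} (hw : w ⬝ᵥ w = 1) {e : ℝ} (he : 0 ≤ e)
    (hcos : ∀ j, -e ≤ hat (A.col j) ⬝ᵥ w) :
    ∑ j, l j * enorm2 (((1 + Matrix.vecMulVec w w) * A).col j)
      ≤ (1 + 2 * e) * ∑ j, l j * enorm2 (A.col j) := by
  have hzero : ∑ j, l j * (enorm2 (A.col j) * (hat (A.col j) ⬝ᵥ w)) = 0 := by
    calc ∑ j, l j * (enorm2 (A.col j) * (hat (A.col j) ⬝ᵥ w)) = ∑ j, l j * (A.col j ⬝ᵥ w) := by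
          refine Finset.sum_congr rfl fun j _ => ?_
          conv_rhs => rw [← enorm2_smul_hat (A.col j)]
          rw [smul_dotProduct, smul_eq_mul]
      _ = (w ᵥ* A) ⬝ᵥ l := by
          refine Finset.sum_congr rfl fun j _ => ?_
          rw [mul_comm, dotProduct_comm (A.col j)]
          rfl
      _ = 0 := by rw [← Matrix.dotProduct_mulVec, hAl, dotProduct_zero]
  calc ∑ j, l j * enorm2 (((1 + Matrix.vecMulVec w w) * A).col j)
      ≤ ∑ j, ((1 + 2 * e) * (l j * enorm2 (A.col j))
          + l j * (enorm2 (A.col j) * (hat (A.col j) ⬝ᵥ w))) := by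
        refine Finset.sum_le_sum fun j _ => ?_
        rw [rescaling_mul_col]
        have h1 := enorm2_rescaling_le hw (A.col j)
        -- For `t ≥ -e` one has `|t| ≤ t + 2e`. The linear term `t` sums to zero by `hzero`, and
        -- only `2e` survives.
        have h2 : |hat (A.col j) ⬝ᵥ w| ≤ hat (A.col j) ⬝ᵥ w + 2 * e :=
          abs_le.2 ⟨by linarith [hcos j], by linarith⟩
        have h3 := mul_le_mul_of_nonneg_left h2 (enorm2_nonneg (A.col j))
        have h4 : enorm2 (A.col j + (w ⬝ᵥ A.col j) • w) ≤ (1 + 2 * e) * enorm2 (A.col j)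
            + enorm2 (A.col j) * (hat (A.col j) ⬝ᵥ w) := by linarith
        have h5 := mul_le_mul_of_nonneg_left h4 (hl j)
        linarith
    _ = _ := by rw [Finset.sum_add_distrib, hzero, ← Finset.mul_sum, add_zero]

end Rescaling

section Update

variable (s : State m n) (k : Fin n)

theorem State.hat_dotProduct_smul_hat :
    (hat (s.A.col k) ⬝ᵥ s.y) • hat (s.A.col k)
      = ((s.A.col k ⬝ᵥ s.y) / enorm2 (s.A.col k) ^ 2) • s.A.col k := by
  rw [hat_eq_smul, smul_dotProduct, smul_smul, smul_eq_mul]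
  congr 1
  rw [div_eq_mul_inv, sq, mul_inv]
  ring

theorem State.update_y (h : s.y = s.A *ᵥ s.x) : (s.update k).y = s.A *ᵥ (s.update k).x := by
  simp only [State.update]
  rw [State.hat_dotProduct_smul_hat, Matrix.mulVec_sub, Matrix.mulVec_smul, ← h,
    Matrix.mulVec_single_one]

theorem State.le_update_x (hc : s.cosine k ≤ 0) (j : Fin n) : s.x j ≤ (s.update k).x j := by
  have h : (s.A.col k ⬝ᵥ s.y) / enorm2 (s.A.col k) ^ 2 ≤ 0 := by
    refine div_nonpos_of_nonpos_of_nonneg ?_ (sq_nonneg _)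
    rw [dotProduct_eq_enorm2_mul]
    exact mul_nonpos_of_nonneg_of_nonpos (mul_nonneg (enorm2_nonneg _) (enorm2_nonneg _)) hc
  simp only [State.update, Pi.sub_apply, Pi.smul_apply, smul_eq_mul]
  rcases eq_or_ne j k with rfl | hj
  · simpa using h
  · simp [hj]

theorem State.update_y_sq_le (hc : s.cosine k < -eps m) :
    (s.update k).y ⬝ᵥ (s.update k).y ≤ (1 - eps m ^ 2) * (s.y ⬝ᵥ s.y) := by
  have h1 : hat (s.A.col k) ⬝ᵥ s.y = enorm2 s.y * s.cosine k := by
    conv_lhs => rw [← enorm2_smul_hat s.y]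
    rw [dotProduct_smul, smul_eq_mul, State.cosine]
  have h2 := hat_dotProduct_self_le (s.A.col k)
  -- The factor `2 - ‖â_k‖²` is at least 1 whether or not the column is zero, which avoids a case
  -- distinction.
  have h3 : (s.update k).y ⬝ᵥ (s.update k).y
      = s.y ⬝ᵥ s.y - (2 - hat (s.A.col k) ⬝ᵥ hat (s.A.col k)) * (hat (s.A.col k) ⬝ᵥ s.y) ^ 2 := by
    simp only [State.update, sub_dotProduct, dotProduct_sub, smul_dotProduct, dotProduct_smul,
      smul_eq_mul]
    rw [dotProduct_comm s.y (hat _)]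
    ring
  rw [h3, h1, mul_pow, enorm2_sq]
  have h4 : eps m ^ 2 ≤ s.cosine k ^ 2 := by nlinarith [eps_nonneg m]
  have h5 := dotProduct_self_nonneg_real s.y
  nlinarith [mul_le_mul_of_nonneg_left h4 h5, mul_nonneg h5 (sq_nonneg (s.cosine k))]

end Update

/-! ### Invariants of a run. -/

namespace Reach

variable {A₀ : Matrix (Fin m) (Fin n) ℝ} {R U : ℕ} {s : State m n}

/-- A rescaling preserves the relation because `I + ŷ ŷᵀ` doubles `y`. -/
theorem y_eq (h : Reach A₀ R U s) : s.y = s.A *ᵥ s.x := by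
  induction h with
  | start => rfl
  | update k h hs hk hc ih => exact State.update_y _ k ih
  | @rescale R U s k h hs hk hc ih =>
    rcases eq_or_ne s.y 0 with h0 | h0
    · simp only [State.rescale]
      rw [← Matrix.mulVec_mulVec, ← ih, h0]
      simp
    · simp only [State.rescale]
      rw [← Matrix.mulVec_mulVec, ← ih, rescaling_mulVec]
      have : (hat s.y ⬝ᵥ s.y) • hat s.y = s.y := by
        have h1 : hat s.y ⬝ᵥ s.y = enorm2 s.y := by
          nth_rw 2 [← enorm2_smul_hat s.y]
          rw [dotProduct_smul, hat_dotProduct_self h0, smul_eq_mul, mul_one]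
        rw [h1, enorm2_smul_hat]
      rw [this, two_smul]

theorem one_le_x (h : Reach A₀ R U s) (j : Fin n) : 1 ≤ s.x j := by
  induction h with
  | start => exact le_rfl
  | @update R U s k h hs hk hc ih =>
    exact ih.trans (State.le_update_x s k (by linarith [eps_nonneg m]) j)
  | rescale k h hs hk hc ih => exact ih

/-- Only left multiplications act on the matrix, so linear relations between the columns of the
input persist: kernel vectors and the expansion in the column basis remain valid. -/
theorem exists_eq_mul (h : Reach A₀ R U s) : ∃ M : Matrix (Fin m) (Fin m) ℝ, s.A = M * A₀ := by
  induction h with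
  | start => exact ⟨1, (Matrix.one_mul _).symm⟩
  | update k h hs hk hc ih => exact ih
  | @rescale R U s k h hs hk hc ih =>
    obtain ⟨M, hM⟩ := ih
    exact ⟨(1 + Matrix.vecMulVec (hat s.y) (hat s.y)) * M, by
      rw [Matrix.mul_assoc, ← hM]; rfl⟩

/-- Rescalings never shorten a vector. Hence a lower bound for `A₀ *ᵥ x` is also one for the current
`y`. -/
theorem mulVec_sq_le (h : Reach A₀ R U s) (v : Fin n → ℝ) :
    (A₀ *ᵥ v) ⬝ᵥ (A₀ *ᵥ v) ≤ (s.A *ᵥ v) ⬝ᵥ (s.A *ᵥ v) := by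
  induction h with
  | start => exact le_rfl
  | update k h hs hk hc ih => exact ih
  | @rescale R U s k h hs hk hc ih =>
    refine ih.trans ?_
    simp only [State.rescale]
    rw [← Matrix.mulVec_mulVec, rescaling_mulVec]
    rcases eq_or_ne s.y 0 with h0 | h0
    · simp [h0, hat_zero]
    · rw [rescaling_dotProduct_self (hat_dotProduct_self h0)]
      nlinarith [sq_nonneg (hat s.y ⬝ᵥ s.A *ᵥ v)]

/-- If `y = 0`, then `A₀ *ᵥ x = 0`, so `x ≥ 1` is its own projection and the stopping test succeeds.
-/
theorem y_ne_zero (h : Reach A₀ R U s) (hs : ¬ Stops A₀ s) : s.y ≠ 0 := by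
  intro h0
  have h1 := h.mulVec_sq_le s.x
  rw [← h.y_eq, h0, dotProduct_zero] at h1
  have h2 : A₀ *ᵥ s.x = 0 :=
    dotProduct_self_eq_zero.1 (le_antisymm h1 (dotProduct_self_nonneg_real _))
  refine hs fun j => ?_
  rw [projKer_eq_self A₀ h2]
  linarith [h.one_le_x j]

theorem y_sq_le (h : Reach A₀ R U s) (hm : 0 < m) :
    s.y ⬝ᵥ s.y ≤ 4 ^ R * (1 - eps m ^ 2) ^ U *
      ((FullSupportKernel.start A₀).y ⬝ᵥ (FullSupportKernel.start A₀).y) := by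
  have hm1 : (1 : ℝ) ≤ m := by exact_mod_cast hm
  have he : 0 ≤ 1 - eps m ^ 2 := by
    have : eps m ≤ 1 := by
      unfold eps
      rw [div_le_one (by positivity)]
      linarith
    nlinarith [eps_nonneg m]
  induction h with
  | start => simp
  | @update R U s k h hs hk hc ih =>
    have h2 := mul_le_mul_of_nonneg_left ih he
    have h1 := State.update_y_sq_le s k hc
    rw [pow_succ]
    linarith
  | @rescale R U s k h hs hk hc ih =>
    simp only [State.rescale, smul_dotProduct, dotProduct_smul, smul_eq_mul]
    rw [pow_succ]
    linarith

theorem eq_submatrix_mul (h : Reach A₀ R U s) {ι : Type*} [Fintype ι] {f : ι → Fin n}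
    {D : Matrix ι (Fin n) ℝ} (hD : A₀ = A₀.submatrix id f * D) : s.A = s.A.submatrix id f * D := by
  obtain ⟨M, hM⟩ := h.exists_eq_mul
  have : s.A.submatrix id f = M * A₀.submatrix id f := by
    rw [hM]; rfl
  rw [this, Matrix.mul_assoc, ← hD, hM]

theorem det_eq (h : Reach A₀ R U s) {ι : Type*} [Fintype ι] [DecidableEq ι] {f : ι → Fin n}
    {D : Matrix ι (Fin n) ℝ} (hD : A₀ = A₀.submatrix id f * D) :
    ((s.A.submatrix id f)ᵀ * s.A.submatrix id f).det
      = 4 ^ R * ((A₀.submatrix id f)ᵀ * A₀.submatrix id f).det := by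
  induction h with
  | start => simp [FullSupportKernel.start]
  | update k h hs hk hc ih => exact ih
  | @rescale R U s k h hs hk hc ih =>
    have h1 := det_rescaling (s.A.submatrix id f) (hat_dotProduct_self (h.y_ne_zero hs))
      -- The coefficients of `ŷ` in the current column basis; the expansion matrix `D` is still that
      -- of the input.
      (c := (enorm2 s.y)⁻¹ • (D *ᵥ s.x)) (by
        rw [Matrix.mulVec_smul, Matrix.mulVec_mulVec, ← h.eq_submatrix_mul hD, ← h.y_eq,
          hat_eq_smul])
    have h2 : s.rescale.A.submatrix id f
        = (1 + Matrix.vecMulVec (hat s.y) (hat s.y)) * s.A.submatrix id f := rfl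
    rw [h2, h1, ih, pow_succ]
    ring

theorem mulVec_eq_zero (h : Reach A₀ R U s) {l : Fin n → ℝ} (hl : A₀ *ᵥ l = 0) :
    s.A *ᵥ l = 0 := by
  obtain ⟨M, hM⟩ := h.exists_eq_mul
  rw [hM, ← Matrix.mulVec_mulVec, hl, Matrix.mulVec_zero]

theorem weight_le (h : Reach A₀ R U s) {l : Fin n → ℝ} (hl : ∀ j, 0 ≤ l j) (hAl : A₀ *ᵥ l = 0) :
    ∑ j, l j * enorm2 (s.A.col j) ≤ (1 + 2 * eps m) ^ R * ∑ j, l j * enorm2 (A₀.col j) := by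
  induction h with
  | start => simp [FullSupportKernel.start]
  | update k h hs hk hc ih => exact ih
  | @rescale R U s k h hs hk hc ih =>
    have h1 := weight_rescaling_le hl (h.mulVec_eq_zero hAl) (hat_dotProduct_self (h.y_ne_zero hs))
      (eps_nonneg m) fun j => (not_lt.1 hc).trans (hk j)
    have h2 := mul_le_mul_of_nonneg_left ih (by linarith [eps_nonneg m] : 0 ≤ 1 + 2 * eps m)
    rw [pow_succ']
    simp only [State.rescale]
    linarith

theorem reflTransGen (h : Reach A₀ R U s) :
    Relation.ReflTransGen (Step A₀) (FullSupportKernel.start A₀) s := by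
  induction h with
  | start => exact .refl
  | update k h hs hk hc ih => exact ih.tail (.update _ k hs hk hc)
  | rescale k h hs hk hc ih => exact ih.tail (.rescale _ k hs hk hc)

theorem exists_of_step (h : Reach A₀ R U s) {t : State m n} (hst : Step A₀ s t) :
    ∃ R' U', R' + U' = R + U + 1 ∧ Reach A₀ R' U' t := by
  cases hst with
  | update k hs hk hc => exact ⟨R, U + 1, by omega, .update k h hs hk hc⟩
  | rescale k hs hk hc => exact ⟨R + 1, U, by omega, .rescale k h hs hk hc⟩

end Reach

/-! ### Bounds on the numbers of rescalings and updates. -/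

section Bounds

variable {R U : ℕ} {s : State m n}

/-- The exponent is `2m · 2ε = 4/11`, which is less than `log 2`. -/
theorem one_add_two_eps_pow_le (hm : 0 < m) : (1 + 2 * eps m) ^ (2 * m) ≤ 2 := by
  have hm1 : (0 : ℝ) < m := by exact_mod_cast hm
  calc (1 + 2 * eps m) ^ (2 * m) ≤ Real.exp (2 * eps m) ^ (2 * m) :=
        pow_le_pow_left₀ (by linarith [eps_nonneg m])
          (by linarith [Real.add_one_le_exp (2 * eps m)]) _
    _ = Real.exp (4 / 11) := by
        rw [← Real.exp_nat_mul]
        congr 1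
        unfold eps
        push_cast
        field_simp
        norm_num
    _ ≤ Real.exp (Real.log 2) := Real.exp_le_exp.2 (by linarith [Real.log_two_gt_d9])
    _ = 2 := Real.exp_log (by norm_num)

/-- Here `121 m² = 1/ε²`, so the power is at most `exp (-1)`. -/
theorem one_sub_eps_sq_pow_le (hm : 0 < m) : (1 - eps m ^ 2) ^ (121 * m ^ 2) ≤ 1 / 2 := by
  have hm1 : (1 : ℝ) ≤ m := by exact_mod_cast hm
  have he : 0 ≤ 1 - eps m ^ 2 := by
    have : eps m ≤ 1 := by
      unfold eps
      rw [div_le_one (by positivity)]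
      linarith
    nlinarith [eps_nonneg m]
  calc (1 - eps m ^ 2) ^ (121 * m ^ 2) ≤ Real.exp (-eps m ^ 2) ^ (121 * m ^ 2) :=
        pow_le_pow_left₀ he (by linarith [Real.add_one_le_exp (-eps m ^ 2)]) _
    _ = Real.exp (-1) := by
        rw [← Real.exp_nat_mul]
        congr 1
        unfold eps
        push_cast
        field_simp
        norm_num
    _ ≤ Real.exp (-Real.log 2) := Real.exp_le_exp.2 (by linarith [Real.log_two_lt_d9])
    _ = 1 / 2 := by rw [Real.exp_neg, Real.exp_log (by norm_num)]; norm_num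

variable {A : Matrix (Fin m) (Fin n) ℤ}

theorem Reach.rescalings_le (h : Reach (hatMatrix (A.map (Int.cast : ℤ → ℝ))) R U s)
    (hA : goffin (A.map (Int.cast : ℤ → ℝ)) < 0) (hm : 0 < m) (hn : 0 < n) :
    R ≤ 6 * (min m n * encodingSize A) := by
  set V := hatMatrix (A.map (Int.cast : ℤ → ℝ)) with hV
  set L := encodingSize A with hL
  obtain ⟨r, f, D, hf, hli, hD, hrm, hrn⟩ := exists_column_basis V
  have h1 := one_le_four_pow_mul_det A hf hli
  have h2 := h.det_eq hD
  have h3 := det_transpose_mul_self_le_prod (s.A.submatrix id f)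
  have hq : 1 ≤ 1 + 2 * eps m := by linarith [eps_nonneg m]
  have hcol : ∀ k, enorm2 (s.A.col k) ≤ (1 + 2 * eps m) ^ R * 4 ^ L := fun k => by
    obtain ⟨l, hl, hVl, hlk, hsum⟩ := exists_nonneg_kernel_vector A hA k hm
    calc enorm2 (s.A.col k) ≤ l k * enorm2 (s.A.col k) :=
          le_mul_of_one_le_left (enorm2_nonneg _) hlk
      _ ≤ ∑ j, l j * enorm2 (s.A.col j) :=
          Finset.single_le_sum (f := fun j => l j * enorm2 (s.A.col j))
            (fun j _ => mul_nonneg (hl j) (enorm2_nonneg _)) (Finset.mem_univ k)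
      _ ≤ (1 + 2 * eps m) ^ R * ∑ j, l j * enorm2 (V.col j) := h.weight_le hl hVl
      _ ≤ (1 + 2 * eps m) ^ R * 4 ^ L := by
          refine mul_le_mul_of_nonneg_left (le_trans ?_ hsum) (by positivity)
          exact Finset.sum_le_sum fun j _ => mul_le_of_le_one_right (hl j) (enorm2_hat_le _)
  have h4 : ∏ i, (s.A.submatrix id f).col i ⬝ᵥ (s.A.submatrix id f).col i
      ≤ (((1 + 2 * eps m) ^ R * 4 ^ L) ^ 2) ^ r := by
    calc _ ≤ ∏ _i : Fin r, ((1 + 2 * eps m) ^ R * 4 ^ L) ^ 2 := by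
          refine Finset.prod_le_prod (fun i _ => dotProduct_self_nonneg_real _) fun i _ => ?_
          rw [← enorm2_sq]
          exact pow_le_pow_left₀ (enorm2_nonneg _) (hcol (f i)) 2
      _ = _ := by simp
  -- Since `r ≤ m`, the factor `(1 + 2ε)^(2r)` per rescaling is at most 2, against the growth by 4
  -- of the determinant.
  have h5 : (((1 + 2 * eps m) ^ R * 4 ^ L) ^ 2) ^ r ≤ 2 ^ R * 4 ^ (2 * r * L) := by
    have e1 : (((1 + 2 * eps m) ^ R * 4 ^ L) ^ 2) ^ r
        = ((1 + 2 * eps m) ^ (2 * r)) ^ R * 4 ^ (2 * r * L) := by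
      simp only [mul_pow, ← pow_mul]
      ring_nf
    rw [e1]
    refine mul_le_mul_of_nonneg_right (pow_le_pow_left₀ (by positivity) ?_ _) (by positivity)
    exact (pow_le_pow_right₀ hq (by omega)).trans (one_add_two_eps_pow_le hm)
  have h6 : (4 : ℝ) ^ R ≤ 4 ^ L * (2 ^ R * 4 ^ (2 * r * L)) := by
    calc (4 : ℝ) ^ R ≤ 4 ^ R * (4 ^ L * ((V.submatrix id f)ᵀ * V.submatrix id f).det) :=
          le_mul_of_one_le_right (by positivity) h1
      _ = 4 ^ L * (4 ^ R * ((V.submatrix id f)ᵀ * V.submatrix id f).det) := by ring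
      _ ≤ _ := by
          rw [← h2]
          exact mul_le_mul_of_nonneg_left (h3.trans (h4.trans h5)) (by positivity)
  -- Comparing exponents of 2 gives `2R ≤ 2L + R + 4rL`, that is `R ≤ 2L + 4rL`.
  have h7 : (2 : ℝ) ^ (2 * R) ≤ 2 ^ (2 * L + R + 2 * (2 * r * L)) := by
    have e4 : (4 : ℝ) = 2 ^ 2 := by norm_num
    rw [e4] at h6
    simp only [← pow_mul, ← pow_add, ← add_assoc] at h6
    exact h6
  have h8 := (pow_le_pow_iff_right₀ (by norm_num : (1 : ℝ) < 2)).1 h7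
  have h9 : r * L ≤ min m n * L := Nat.mul_le_mul_right _ (le_min hrm hrn)
  have h10 : 1 * L ≤ min m n * L := Nat.mul_le_mul_right _ (by omega)
  have h11 : 2 * (2 * r * L) = 4 * (r * L) := by ring
  omega

theorem start_y_sq_le (A : Matrix (Fin m) (Fin n) ℝ) :
    (start (hatMatrix A)).y ⬝ᵥ (start (hatMatrix A)).y ≤ n ^ 2 := by
  have h1 : ∀ i, (start (hatMatrix A)).y i * (start (hatMatrix A)).y i
      ≤ n * ∑ j, hatMatrix A i j ^ 2 := fun i => by
    have := sq_sum_le_card_mul_sum_sq (s := Finset.univ) (f := fun j => hatMatrix A i j)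
    simpa [start, Matrix.mulVec, dotProduct, pow_two] using this
  calc (start (hatMatrix A)).y ⬝ᵥ (start (hatMatrix A)).y
      ≤ ∑ i, n * ∑ j, hatMatrix A i j ^ 2 := Finset.sum_le_sum fun i _ => h1 i
    _ = n * ∑ j, hat (A.col j) ⬝ᵥ hat (A.col j) := by
        rw [← Finset.mul_sum, Finset.sum_comm]
        simp [dotProduct, hatMatrix, pow_two]
    _ ≤ n * ∑ _j : Fin n, 1 := mul_le_mul_of_nonneg_left
        (Finset.sum_le_sum fun j _ => hat_dotProduct_self_le _) (by positivity)
    _ = n ^ 2 := by simp [pow_two]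

theorem Reach.updates_lt (h : Reach (hatMatrix (A.map (Int.cast : ℤ → ℝ))) R U s)
    (hs : ¬ Stops (hatMatrix (A.map (Int.cast : ℤ → ℝ))) s) (hm : 0 < m) :
    U < 121 * m ^ 2 * (5 * encodingSize A + 2 * R + 1) := by
  set V := hatMatrix (A.map (Int.cast : ℤ → ℝ)) with hV
  set L := encodingSize A with hL
  set N := 121 * m ^ 2 with hN
  have hNpos : 0 < N := by positivity
  have hnL : n ≤ L := (Nat.le_mul_of_pos_left n hm).trans (mul_le_encodingSize A)
  have hn2 : (n : ℝ) ≤ 2 ^ L := by exact_mod_cast hnL.trans Nat.lt_two_pow_self.le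
  have hm1 : (1 : ℝ) ≤ m := by exact_mod_cast hm
  have he1 : eps m ≤ 1 := by
    unfold eps
    rw [div_le_one (by positivity)]
    linarith
  have he : 0 ≤ 1 - eps m ^ 2 := by nlinarith [eps_nonneg m]
  have he' : 1 - eps m ^ 2 ≤ 1 := by nlinarith [eps_nonneg m]
  have h1 := one_le_mul_of_not_projKer_pos A h.one_le_x hs
  have h2 := h.mulVec_sq_le s.x
  rw [← h.y_eq] at h2
  have h3 := h.y_sq_le hm
  have h4 := start_y_sq_le (A.map (Int.cast : ℤ → ℝ))
  have h5 : (1 - eps m ^ 2) ^ U ≤ (1 / 2) ^ (U / N) := by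
    calc (1 - eps m ^ 2) ^ U ≤ (1 - eps m ^ 2) ^ (N * (U / N)) :=
          pow_le_pow_of_le_one he he' (Nat.mul_div_le U N)
      _ = ((1 - eps m ^ 2) ^ N) ^ (U / N) := pow_mul _ _ _
      _ ≤ _ := pow_le_pow_left₀ (pow_nonneg he _) (one_sub_eps_sq_pow_le hm) _
  have h6 : (1 : ℝ) ≤ 2 ^ L * 4 ^ L * (4 ^ R * (1 / 2) ^ (U / N) * (2 ^ L) ^ 2) := by
    refine h1.trans ?_
    have h7 : (V *ᵥ s.x) ⬝ᵥ (V *ᵥ s.x) ≤ 4 ^ R * (1 / 2) ^ (U / N) * (2 ^ L) ^ 2 := by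
      refine h2.trans (h3.trans ?_)
      have h8 : (FullSupportKernel.start V).y ⬝ᵥ (FullSupportKernel.start V).y ≤ (2 ^ L) ^ 2 :=
        h4.trans (pow_le_pow_left₀ (by positivity) hn2 2)
      have h9 : 4 ^ R * (1 - eps m ^ 2) ^ U ≤ 4 ^ R * (1 / 2) ^ (U / N) :=
        mul_le_mul_of_nonneg_left h5 (by positivity)
      exact mul_le_mul h9 h8 (dotProduct_self_nonneg_real _) (by positivity)
    exact mul_le_mul (mul_le_mul_of_nonneg_right hn2 (by positivity)) h7
      (dotProduct_self_nonneg_real _) (by positivity)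
  -- Solving `h6` for the power of 2: the exponent `5L` collects `n ≤ 2^L`, the factor `4^L`, and
  -- `n² ≤ (2^L)²` from the initial `y`. The quotient `U / N` is rounded down, whence the `+ 1` in
  -- the claim.
  have h7 : (2 : ℝ) ^ (U / N) ≤ 2 ^ (5 * L + 2 * R) := by
    have e4 : (4 : ℝ) = 2 ^ 2 := by norm_num
    have e5 : (2 : ℝ) ^ (5 * L + 2 * R) = 2 ^ L * 4 ^ L * (4 ^ R * (2 ^ L) ^ 2) := by
      rw [e4]
      simp only [← pow_mul, ← pow_add]
      congr 1
      ring
    rw [e5]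
    rw [one_div, inv_pow] at h6
    have hp : (0 : ℝ) < 2 ^ (U / N) := by positivity
    calc (2 : ℝ) ^ (U / N) = 2 ^ (U / N) * 1 := (mul_one _).symm
      _ ≤ 2 ^ (U / N) * (2 ^ L * 4 ^ L * (4 ^ R * (2 ^ (U / N))⁻¹ * (2 ^ L) ^ 2)) :=
          mul_le_mul_of_nonneg_left h6 hp.le
      _ = _ := by field_simp
  have h8 := (pow_le_pow_iff_right₀ (by norm_num : (1 : ℝ) < 2)).1 h7
  rw [mul_comm]
  exact (Nat.div_lt_iff_lt_mul hNpos).1 (by omega)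

theorem Reach.updates_lt_of_goffin (h : Reach (hatMatrix (A.map (Int.cast : ℤ → ℝ))) R U s)
    (hs : ¬ Stops (hatMatrix (A.map (Int.cast : ℤ → ℝ))) s)
    (hA : goffin (A.map (Int.cast : ℤ → ℝ)) < 0) (hm : 0 < m) (hn : 0 < n) :
    U < 2178 * (m ^ 2 * (min m n * encodingSize A)) := by
  have h1 := h.updates_lt hs hm
  have h2 := h.rescalings_le hA hm hn
  have hL : 0 < encodingSize A := lt_of_lt_of_le (by positivity) (mul_le_encodingSize A)
  have h3 : 1 * encodingSize A ≤ min m n * encodingSize A := Nat.mul_le_mul_right _ (by omega)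
  -- With `R ≤ 6 min(m,n) L` the bracket is at most `5 + 12 + 1 = 18` times `min(m,n) L`.
  calc U < 121 * m ^ 2 * (5 * encodingSize A + 2 * R + 1) := h1
    _ ≤ 121 * m ^ 2 * (18 * (min m n * encodingSize A)) := Nat.mul_le_mul_left _ (by omega)
    _ = _ := by ring

/-- This also covers states that pass the stopping test: the last update started from a state that
did not, where the strict inequality leaves room for one more. -/
theorem Reach.updates_le (h : Reach (hatMatrix (A.map (Int.cast : ℤ → ℝ))) R U s)
    (hA : goffin (A.map (Int.cast : ℤ → ℝ)) < 0) (hm : 0 < m) (hn : 0 < n) :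
    U ≤ 2178 * (m ^ 2 * (min m n * encodingSize A)) := by
  induction h with
  | start => exact Nat.zero_le _
  | update k h hs hk hc ih => exact h.updates_lt_of_goffin hs hA hm hn
  | rescale k h hs hk hc ih => exact ih

theorem not_exists_infinite_run (hA : goffin (A.map (Int.cast : ℤ → ℝ)) < 0) (hm : 0 < m)
    (hn : 0 < n) :
    ¬ ∃ s : ℕ → State m n, s 0 = start (hatMatrix (A.map (Int.cast : ℤ → ℝ))) ∧
      ∀ t, Step (hatMatrix (A.map (Int.cast : ℤ → ℝ))) (s t) (s (t + 1)) := by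
  rintro ⟨s, h0, hs⟩
  have key : ∀ t, ∃ R U, R + U = t ∧ Reach (hatMatrix (A.map (Int.cast : ℤ → ℝ))) R U (s t) := by
    intro t
    induction t with
    | zero => exact ⟨0, 0, rfl, h0 ▸ .start⟩
    | succ t ih =>
      obtain ⟨R, U, hRU, h⟩ := ih
      obtain ⟨R', U', hRU', h'⟩ := h.exists_of_step (hs t)
      exact ⟨R', U', by omega, h'⟩
  obtain ⟨R, U, hRU, h⟩ := key
    (6 * (min m n * encodingSize A) + 2178 * (m ^ 2 * (min m n * encodingSize A)) + 1)
  have h1 := h.rescalings_le hA hm hn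
  have h2 := h.updates_le hA hm hn
  omega

theorem Returns.kernelFeasible {A₀ : Matrix (Fin m) (Fin n) ℝ} {xbar : Fin n → ℝ}
    (h : Returns A₀ xbar) : KernelFeasible A₀ xbar := by
  obtain ⟨s, -, hs, rfl⟩ := h
  exact ⟨mulVec_projKer A₀ s.x, hs⟩

end Bounds

/-! ### Values and costs of the basic programs. -/

namespace Counted

section Basic

variable {α β : Type}

theorem val_bind (c : Counted α) (f : α → Counted β) : (c >>= f).val = (f c.val).val := rfl

theorem ops_bind (c : Counted α) (f : α → Counted β) :
    (c >>= f).ops = c.ops + (f c.val).ops := rfl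

theorem val_pure (a : α) : (pure a : Counted α).val = a := rfl

theorem ops_pure (a : α) : (pure a : Counted α).ops = 0 := rfl

theorem ops_ite_le {p : Prop} [Decidable p] {a b : Counted α} {c : ℕ} (ha : a.ops ≤ c)
    (hb : b.ops ≤ c) : (if p then a else b).ops ≤ c := by
  split_ifs
  exacts [ha, hb]

theorem val_foldlM (l : List α) (f : β → α → Counted β) (b : β) :
    (l.foldlM f b).val = l.foldl (fun b a => (f b a).val) b := by
  induction l generalizing b with
  | nil => rfl
  | cons a l ih => rw [List.foldlM_cons, val_bind, ih]; rfl

theorem ops_foldlM_le (l : List α) (f : β → α → Counted β) {c : ℕ} (hc : ∀ b a, (f b a).ops ≤ c)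
    (b : β) : (l.foldlM f b).ops ≤ l.length * c := by
  induction l generalizing b with
  | nil => exact Nat.zero_le _
  | cons a l ih =>
    rw [List.foldlM_cons, ops_bind, List.length_cons, Nat.succ_mul, add_comm]
    exact Nat.add_le_add (ih _) (hc b a)

theorem ops_table_le {n : ℕ} (f : Fin n → Counted α) {c : ℕ} (hc : ∀ i, (f i).ops ≤ c) :
    (table f).ops ≤ n * c := by
  have h : ∑ i, (f i).ops ≤ ∑ _i : Fin n, c := Finset.sum_le_sum fun i _ => hc i
  refine h.trans ?_
  simp

theorem ops_tableMatrix_le {K : Type} {m n : ℕ} (f : Fin m → Fin n → Counted K) {c : ℕ}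
    (hc : ∀ i j, (f i j).ops ≤ c) : (tableMatrix f).ops ≤ m * (n * c) := by
  have h : ∑ i, ∑ j, (f i j).ops ≤ ∑ _i : Fin m, ∑ _j : Fin n, c :=
    Finset.sum_le_sum fun i _ => Finset.sum_le_sum fun j _ => hc i j
  refine h.trans ?_
  simp

end Basic

variable {n : ℕ}

theorem val_inner (u v : Fin n → ℝ) : (Counted.inner u v).val = u ⬝ᵥ v := by
  have h : ∀ (l : List (Fin n)) (b : ℝ),
      l.foldl (fun acc i => acc + u i * v i) b = b + (l.map fun i => u i * v i).sum := by
    intro l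
    induction l with
    | nil => simp
    | cons a l ih => intro b; simp [ih, add_assoc]
  unfold Counted.inner
  rw [val_foldlM]
  refine (h _ 0).trans ?_
  rw [zero_add, dotProduct, Fin.sum_univ_def]

theorem ops_inner_le (u v : Fin n → ℝ) : (Counted.inner u v).ops ≤ n * 2 := by
  have := ops_foldlM_le (List.finRange n)
    (fun acc i => do let p ← times (u i) (v i); plus acc p) (c := 2) (fun _ _ => le_rfl) (0 : ℝ)
  rwa [List.length_finRange] at this

theorem val_allPos (v : Fin n → ℝ) : (allPos v).val = true ↔ ∀ j, 0 < v j := by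
  have h : ∀ (l : List (Fin n)) (b : Bool),
      l.foldl (fun b i => b && decide (0 < v i)) b = true ↔ b = true ∧ ∀ i ∈ l, 0 < v i := by
    intro l
    induction l with
    | nil => simp
    | cons a l ih => intro b; simp [ih, and_assoc]
  unfold allPos
  rw [val_foldlM]
  refine (h _ true).trans ?_
  simp

theorem ops_allPos_le (v : Fin n → ℝ) : (allPos v).ops ≤ n := by
  have := ops_foldlM_le (List.finRange n)
    (fun b i => do let p ← less 0 (v i); pure (b && p)) (c := 1) (fun _ _ => le_rfl) true
  rwa [List.length_finRange, mul_one] at this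

end Counted

open Counted

/-! ### Correctness and cost of the projection matrix. -/

section KernelProjection

variable {m n : ℕ}

/-- The step of `kernelProjection` for the row `r`. -/
noncomputable def eliminate (P : Matrix (Fin n) (Fin n) ℝ) (r : Fin n → ℝ) :
    Matrix (Fin n) (Fin n) ℝ :=
  P - ((P *ᵥ r) ⬝ᵥ (P *ᵥ r))⁻¹ • Matrix.vecMulVec (P *ᵥ r) (P *ᵥ r)

theorem eliminate_mulVec (P : Matrix (Fin n) (Fin n) ℝ) (r u : Fin n → ℝ) :
    eliminate P r *ᵥ u
      = P *ᵥ u - (((P *ᵥ r) ⬝ᵥ (P *ᵥ r))⁻¹ * ((P *ᵥ r) ⬝ᵥ u)) • (P *ᵥ r) := by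
  rw [eliminate, Matrix.sub_mulVec, Matrix.smul_mulVec, Matrix.vecMulVec_mulVec]
  simp [smul_smul]

/-- `P` is the matrix of an orthogonal projection. -/
def IsOrthProj (P : Matrix (Fin n) (Fin n) ℝ) : Prop := P.IsSymm ∧ ∀ u, P *ᵥ (P *ᵥ u) = P *ᵥ u

theorem IsOrthProj.dotProduct_comm {P : Matrix (Fin n) (Fin n) ℝ} (hP : IsOrthProj P)
    (u v : Fin n → ℝ) : (P *ᵥ u) ⬝ᵥ v = u ⬝ᵥ (P *ᵥ v) := by
  rw [Matrix.dotProduct_mulVec, ← Matrix.mulVec_transpose, hP.1.eq]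

theorem IsOrthProj.eliminate_mulVec_self {P : Matrix (Fin n) (Fin n) ℝ} (hP : IsOrthProj P)
    (r : Fin n → ℝ) : eliminate P r *ᵥ r = 0 := by
  rw [eliminate_mulVec]
  have h : (P *ᵥ r) ⬝ᵥ r = (P *ᵥ r) ⬝ᵥ (P *ᵥ r) := by
    rw [hP.dotProduct_comm r (P *ᵥ r), hP.2, hP.dotProduct_comm]
  rw [h]
  rcases eq_or_ne ((P *ᵥ r) ⬝ᵥ (P *ᵥ r)) 0 with h0 | h0
  · rw [dotProduct_self_eq_zero.1 h0]
    simp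
  · rw [inv_mul_cancel₀ h0, one_smul, sub_self]

/-- Subtracting the projection to the line of `P r`, which lies in the image of `P`, leaves the
projection to the orthogonal complement of that line within the image. -/
theorem IsOrthProj.eliminate {P : Matrix (Fin n) (Fin n) ℝ} (hP : IsOrthProj P)
    (r : Fin n → ℝ) : IsOrthProj (eliminate P r) := by
  refine ⟨?_, fun u => ?_⟩
  · rw [Matrix.IsSymm, FullSupportKernel.eliminate, Matrix.transpose_sub, Matrix.transpose_smul,
      Matrix.transpose_vecMulVec, hP.1.eq]
  · have h1 : FullSupportKernel.eliminate P r *ᵥ (P *ᵥ u)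
        = FullSupportKernel.eliminate P r *ᵥ u := by
      rw [eliminate_mulVec, eliminate_mulVec, hP.2, ← hP.dotProduct_comm (P *ᵥ r) u,
        hP.2]
    have h2 : FullSupportKernel.eliminate P r *ᵥ (P *ᵥ r) = 0 := by
      rw [eliminate_mulVec, hP.2]
      rcases eq_or_ne ((P *ᵥ r) ⬝ᵥ (P *ᵥ r)) 0 with h0 | h0
      · rw [dotProduct_self_eq_zero.1 h0]
        simp
      · rw [inv_mul_cancel₀ h0, one_smul, sub_self]
    rw [eliminate_mulVec P r u, Matrix.mulVec_sub, Matrix.mulVec_smul, h1, h2, smul_zero, sub_zero,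
      eliminate_mulVec]

theorem IsOrthProj.eliminate_mulVec_eq {P : Matrix (Fin n) (Fin n) ℝ} (hP : IsOrthProj P)
    {r u : Fin n → ℝ} (h : r ⬝ᵥ (P *ᵥ u) = 0) :
    FullSupportKernel.eliminate P r *ᵥ u = P *ᵥ u := by
  rw [eliminate_mulVec, hP.dotProduct_comm r u, h, mul_zero, zero_smul, sub_zero]

theorem val_kernelProjection (A : Matrix (Fin m) (Fin n) ℝ) :
    (kernelProjection A).val
      = (List.finRange m).foldl (fun P i => eliminate P (A i)) 1 := by
  unfold kernelProjection
  rw [val_foldlM]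
  congr 1
  ext P i j l
  have hv : (table fun j => Counted.inner (P j) (A i)).val = P *ᵥ A i :=
    funext fun j => val_inner _ _
  simp only [val_bind, hv, val_inner, isZero]
  split_ifs with h
  -- In the branch skipped by the program `eliminate` does not change `P` either, because its
  -- correction term vanishes.
  · have h0 : P *ᵥ A i = 0 := dotProduct_self_eq_zero.1 (of_decide_eq_true h)
    simp [eliminate, val_pure, h0]
  · simp [eliminate, tableMatrix, val_bind, times, divide, minus, Matrix.vecMulVec_apply]
    ring

/-- Throughout the loop the matrix is an orthogonal projection that fixes `ker A` and annihilates
the rows already treated. At the end symmetry turns annihilation of all rows into `A P x = 0`, and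
fixing the kernel makes `x - P x` orthogonal to it. -/
theorem kernelProjection_mulVec (A : Matrix (Fin m) (Fin n) ℝ) (x : Fin n → ℝ) :
    (kernelProjection A).val *ᵥ x = projKer A x := by
  have h : ∀ (l : List (Fin m)) (P : Matrix (Fin n) (Fin n) ℝ), IsOrthProj P →
      (∀ u, A *ᵥ u = 0 → P *ᵥ u = u) →
      IsOrthProj (l.foldl (fun P i => eliminate P (A i)) P) ∧
      (∀ u, A *ᵥ u = 0 → (l.foldl (fun P i => eliminate P (A i)) P) *ᵥ u = u) ∧
      (∀ u, P *ᵥ u = 0 → (l.foldl (fun P i => eliminate P (A i)) P) *ᵥ u = 0) ∧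
      ∀ i ∈ l, (l.foldl (fun P i => eliminate P (A i)) P) *ᵥ A i = 0 := by
    intro l
    induction l with
    | nil => exact fun P hP hu => ⟨hP, hu, fun _ h => h, by simp⟩
    | cons i l ih =>
      intro P hP hu
      obtain ⟨h1, h2, h3, h4⟩ := ih (eliminate P (A i)) (hP.eliminate _) fun u hAu => by
        rw [hP.eliminate_mulVec_eq, hu u hAu]
        rw [hu u hAu]
        exact congrFun hAu i
      refine ⟨h1, h2, fun u h0 => h3 u ?_, fun j hj => ?_⟩
      · rw [hP.eliminate_mulVec_eq, h0]
        rw [h0, dotProduct_zero]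
      · rcases List.mem_cons.1 hj with rfl | hj
        · exact h3 _ (hP.eliminate_mulVec_self _)
        · exact h4 j hj
  obtain ⟨h1, h2, -, h4⟩ := h (List.finRange m) 1 ⟨by simp [Matrix.IsSymm], by simp⟩ (by simp)
  rw [← val_kernelProjection] at h1 h2 h4
  refine eq_projKer A ?_ fun u hu => ?_
  · ext i
    change A i ⬝ᵥ _ = 0
    rw [← h1.dotProduct_comm, h4 i (List.mem_finRange i), zero_dotProduct]
  · rw [sub_dotProduct, h1.dotProduct_comm, h2 u hu, sub_self]

theorem ops_kernelProjection_le (A : Matrix (Fin m) (Fin n) ℝ) :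
    (kernelProjection A).ops ≤ m * (n * (n * 2) + n * 2 + 1 + n * (n * 3)) := by
  have := ops_foldlM_le (List.finRange m) (fun (P : Matrix (Fin n) (Fin n) ℝ) i => do
    let v ← table fun j => Counted.inner (P j) (A i)
    let q ← Counted.inner v v
    let b ← isZero q
    if b then pure P
    else tableMatrix fun j l => do
      let p ← times (v j) (v l)
      let r ← divide p q
      minus (P j l) r) (c := n * (n * 2) + n * 2 + 1 + n * (n * 3)) (fun P i => ?_) 1
  · rwa [List.length_finRange] at this
  · simp only [ops_bind]
    rw [add_assoc, add_assoc]
    refine Nat.add_le_add (ops_table_le _ fun j => ops_inner_le _ _) ?_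
    refine Nat.add_le_add (ops_inner_le _ _) (Nat.add_le_add le_rfl ?_)
    refine ops_ite_le (Nat.zero_le _) ?_
    exact ops_tableMatrix_le _ fun j l => le_rfl

end KernelProjection

/-! ### The program simulates the algorithm. -/

section Memory

variable {m n : ℕ}

/-- The memory contents that belong to a state of the algorithm. -/
structure Represents (A₀ : Matrix (Fin m) (Fin n) ℝ) (M : Memory ℝ m n) (s : State m n) :
    Prop where
  A_eq : M.A = s.A
  F_eq : ∀ j l, M.F j l = s.A.col j ⬝ᵥ s.A.col l
  x_eq : M.x = s.x
  y_eq : M.y = s.y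
  z_eq : ∀ j, M.z j = s.A.col j ⬝ᵥ s.y
  xbar_eq : M.xbar = projKer A₀ s.x

variable {A₀ : Matrix (Fin m) (Fin n) ℝ} {P : Matrix (Fin n) (Fin n) ℝ} {M : Memory ℝ m n}
  {s : State m n}

theorem represents_prepare (hP : ∀ x, P *ᵥ x = projKer A₀ x) :
    Represents A₀ (prepare A₀ P).val (start A₀) := by
  have hy : (table fun i => Counted.inner (A₀ i) fun _ => (1 : ℝ)).val = (start A₀).y :=
    funext fun i => val_inner _ _
  constructor
  · rfl
  · intro j l
    exact val_inner _ _
  · rfl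
  · exact hy
  · intro j
    simp only [prepare, val_bind, val_pure, hy]
    exact val_inner _ _
  · simp only [prepare, val_bind, val_pure, table, val_inner]
    exact hP _

theorem ops_prepare_le (A : Matrix (Fin m) (Fin n) ℝ) (P : Matrix (Fin n) (Fin n) ℝ) :
    (prepare A P).ops ≤ m * (n * 2) + (n * (n * (m * 2)) + (n * (m * 2) + n * (n * 2))) := by
  simp only [prepare, ops_bind, ops_pure, add_zero]
  refine Nat.add_le_add (ops_table_le _ fun _ => ops_inner_le _ _) ?_
  refine Nat.add_le_add (ops_tableMatrix_le _ fun _ _ => ops_inner_le _ _) ?_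
  exact Nat.add_le_add (ops_table_le _ fun _ => ops_inner_le _ _)
    (ops_table_le _ fun _ => ops_inner_le _ _)

/-- This is why comparing signed squares, free of square roots, decides comparisons of cosines. -/
theorem mul_abs_self_strictMono : StrictMono fun t : ℝ => t * |t| := by
  intro a b h
  simp only
  rcases abs_cases a with ⟨ha, ha'⟩ | ⟨ha, ha'⟩ <;> rcases abs_cases b with ⟨hb, hb'⟩ | ⟨hb, hb'⟩ <;>
    rw [ha, hb] <;> nlinarith

theorem val_score (v y : Fin m → ℝ) :
    (score (v ⬝ᵥ y) (v ⬝ᵥ v)).val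
      = (enorm2 y * (hat v ⬝ᵥ hat y)) * |enorm2 y * (hat v ⬝ᵥ hat y)| := by
  rcases eq_or_ne v 0 with rfl | hv
  · simp [score, val_bind, isZero, val_pure, hat_zero]
  have hpos := enorm2_pos.2 hv
  set t := enorm2 y * (hat v ⬝ᵥ hat y) with ht
  have hz : v ⬝ᵥ y = enorm2 v * t := by rw [dotProduct_eq_enorm2_mul, ht, mul_assoc]
  have hq : enorm2 v * t * (enorm2 v * t) / enorm2 v ^ 2 = t * t := by
    field_simp
  have hneg : enorm2 v * t < 0 ↔ t < 0 := by
    constructor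
    · intro h; by_contra! h'; nlinarith [mul_nonneg hpos.le h']
    · intro h; nlinarith
  simp only [score, val_bind, isZero, times, divide, less, hz, ← enorm2_sq]
  have he : enorm2 v ^ 2 ≠ 0 := by positivity
  rcases lt_or_ge t 0 with h | h
  · simp [he, hneg, h, val_bind, minus, hq, abs_of_neg h]
  · simp [he, hneg, not_lt.2 h, val_bind, val_pure, hq, abs_of_nonneg h]

theorem ops_score_le (z f : ℝ) : (score z f).ops ≤ 5 := by
  unfold score
  rw [ops_bind]
  refine (Nat.add_le_add (le_refl 1) (ops_ite_le (c := 4) (Nat.zero_le _) ?_)).trans le_rfl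
  rw [ops_bind, ops_bind, ops_bind]
  have : ∀ (b : Bool) (q : ℝ), (if b then minus 0 q else pure q : Counted ℝ).ops ≤ 1 :=
    fun b q => ops_ite_le le_rfl (Nat.zero_le _)
  exact Nat.add_le_add le_rfl (Nat.add_le_add le_rfl (Nat.add_le_add le_rfl (this _ _)))

theorem val_leastScore (σ : Equiv.Perm (Fin n)) (M : Memory ℝ m n) (hn : 0 < n) :
    ∃ k, (leastScore σ M).val = some (k, (score (M.z k) (M.F k k)).val) ∧
      ∀ j, (score (M.z k) (M.F k k)).val ≤ (score (M.z j) (M.F j j)).val := by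
  set sc : Fin n → ℝ := fun j => (score (M.z j) (M.F j j)).val with hsc
  set f : Option (Fin n × ℝ) → Fin n → Option (Fin n × ℝ) := fun best j =>
    match best with
    | none => some (j, sc j)
    | some (k, d) => if sc j < d then some (j, sc j) else some (k, d) with hf
  have hval : (leastScore σ M).val = ((List.finRange n).map σ).foldl f none := by
    unfold leastScore
    rw [val_foldlM]
    congr 1
    ext best j
    rcases best with _ | ⟨k, d⟩
    · rfl
    · simp [hf, val_bind, less, val_pure, hsc]
  have key : ∀ (l : List (Fin n)) (k : Fin n), ∃ k', l.foldl f (some (k, sc k)) = some (k', sc k') ∧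
      sc k' ≤ sc k ∧ ∀ j ∈ l, sc k' ≤ sc j := by
    intro l
    induction l with
    | nil => exact fun k => ⟨k, rfl, le_rfl, by simp⟩
    | cons i l ih =>
      intro k
      by_cases h : sc i < sc k
      · obtain ⟨k', h1, h2, h3⟩ := ih i
        refine ⟨k', by simpa [hf, h] using h1, h2.trans h.le, fun j hj => ?_⟩
        rcases List.mem_cons.1 hj with rfl | hj
        exacts [h2, h3 j hj]
      · obtain ⟨k', h1, h2, h3⟩ := ih k
        refine ⟨k', by simpa [hf, h] using h1, h2, fun j hj => ?_⟩
        rcases List.mem_cons.1 hj with rfl | hj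
        exacts [h2.trans (not_lt.1 h), h3 j hj]
  have hmem : ∀ j, j ∈ (List.finRange n).map σ := fun j =>
    List.mem_map.2 ⟨σ.symm j, List.mem_finRange _, by simp⟩
  rw [hval]
  rcases hl : (List.finRange n).map σ with _ | ⟨i, l⟩
  · have := hmem ⟨0, hn⟩
    simp [hl] at this
  · obtain ⟨k, h1, h2, h3⟩ := key l i
    refine ⟨k, h1, fun j => ?_⟩
    have := hmem j
    rw [hl] at this
    rcases List.mem_cons.1 this with rfl | hj
    exacts [h2, h3 j hj]

theorem ops_leastScore_le (σ : Equiv.Perm (Fin n)) (M : Memory ℝ m n) :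
    (leastScore σ M).ops ≤ n * 6 := by
  unfold leastScore
  refine (ops_foldlM_le _ _ (c := 6) (fun best j => ?_) _).trans (by simp)
  rw [ops_bind]
  refine (Nat.add_le_add (ops_score_le _ _) (?_ : _ ≤ 1)).trans le_rfl
  rcases best with _ | ⟨k, d⟩
  · exact Nat.zero_le _
  · exact le_rfl

theorem Represents.updateMemory (h : Represents A₀ M s) (hP : ∀ x, P *ᵥ x = projKer A₀ x)
    (k : Fin n) : Represents A₀ (updateMemory P M k).val (s.update k) := by
  have hc : M.z k / M.F k k = (s.A.col k ⬝ᵥ s.y) / enorm2 (s.A.col k) ^ 2 := by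
    rw [h.z_eq, h.F_eq, enorm2_sq]
  set c := (s.A.col k ⬝ᵥ s.y) / enorm2 (s.A.col k) ^ 2 with hcdef
  have hx : (s.update k).x = s.x - c • Pi.single k (1 : ℝ) := rfl
  have hy : (s.update k).y = s.y - c • s.A.col k := by
    rw [hcdef, ← State.hat_dotProduct_smul_hat]
    rfl
  constructor
  · exact h.A_eq
  · exact h.F_eq
  · change Function.update M.x k (M.x k - M.z k / M.F k k) = _
    rw [hc, h.x_eq, hx]
    ext j
    rcases eq_or_ne j k with rfl | hj
    · simp
    · simp [hj]
  · change (fun i => M.y i - M.z k / M.F k k * M.A i k) = _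
    rw [hc, h.y_eq, h.A_eq, hy]
    rfl
  · intro j
    change M.z j - M.z k / M.F k k * M.F j k = s.A.col j ⬝ᵥ (s.update k).y
    rw [hc, h.z_eq, h.F_eq, hy, dotProduct_sub, dotProduct_smul, smul_eq_mul]
  · change (fun j => M.xbar j - M.z k / M.F k k * P j k) = _
    rw [hc, h.xbar_eq, hx, ← hP, ← hP, Matrix.mulVec_sub, Matrix.mulVec_smul,
      Matrix.mulVec_single_one]
    rfl

theorem ops_updateMemory_le (P : Matrix (Fin n) (Fin n) ℝ) (M : Memory ℝ m n) (k : Fin n) :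
    (updateMemory P M k).ops ≤ 2 + 2 * m + 4 * n := by
  have h1 : (updateMemory P M k).ops = 1 + (1 + (_ + (_ + (_ + 0)))) := rfl
  rw [h1]
  refine (Nat.add_le_add_left (Nat.add_le_add_left (Nat.add_le_add
    (ops_table_le (c := 2) _ fun _ => le_rfl) (Nat.add_le_add
    (ops_table_le (c := 2) _ fun _ => le_rfl) (Nat.add_le_add_right
    (ops_table_le (c := 2) _ fun _ => le_rfl) 0))) 1) 1).trans (by omega)

/-- The component of each column along `ŷ` is doubled. Inner products of columns therefore gain
three times the product of these components, and `z` picks up one factor 2 from the columns and one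
from `y`. -/
theorem Represents.rescaleMemory (h : Represents A₀ M s) (hy : s.y ≠ 0) :
    Represents A₀ (rescaleMemory M (s.y ⬝ᵥ s.y)).val s.rescale := by
  have hpos := enorm2_pos.2 hy
  have hw := hat_dotProduct_self hy
  have hcol : ∀ j, s.rescale.A.col j = s.A.col j + (hat s.y ⬝ᵥ s.A.col j) • hat s.y := fun j =>
    rescaling_mul_col _ _ _
  have hzj : ∀ j, hat s.y ⬝ᵥ s.A.col j = (enorm2 s.y)⁻¹ * M.z j := fun j => by
    rw [hat_eq_smul, smul_dotProduct, h.z_eq, dotProduct_comm, smul_eq_mul]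
  constructor
  · change (Matrix.of fun i j => M.A i j + M.y i * (M.z j / (s.y ⬝ᵥ s.y))) = _
    ext i j
    have := congrFun (hcol j) i
    rw [Matrix.col_apply] at this
    rw [this, hzj, hat_eq_smul, ← enorm2_sq, h.A_eq, h.y_eq]
    simp only [Matrix.of_apply, Pi.add_apply, Pi.smul_apply, smul_eq_mul, Matrix.col_apply]
    field_simp
  · intro j l
    change M.F j l + 3 * (M.z j * (M.z l / (s.y ⬝ᵥ s.y))) = _
    rw [hcol, hcol, h.F_eq]
    simp only [add_dotProduct, dotProduct_add, smul_dotProduct, dotProduct_smul, smul_eq_mul, hw]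
    rw [dotProduct_comm (s.A.col j) (hat s.y), hzj, hzj, ← enorm2_sq]
    field_simp
    ring
  · exact h.x_eq
  · change (fun i => 2 * M.y i) = _
    rw [h.y_eq]
    rfl
  · intro j
    change 4 * M.z j = s.rescale.A.col j ⬝ᵥ ((2 : ℝ) • s.y)
    have hyy : hat s.y ⬝ᵥ s.y = enorm2 s.y := by
      nth_rw 2 [← enorm2_smul_hat s.y]
      rw [dotProduct_smul, hw, smul_eq_mul, mul_one]
    rw [hcol, dotProduct_smul, add_dotProduct, smul_dotProduct, hzj, hyy, h.z_eq, smul_eq_mul,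
      smul_eq_mul]
    field_simp
    ring
  · exact h.xbar_eq

theorem ops_rescaleMemory_le (M : Memory ℝ m n) (q : ℝ) :
    (rescaleMemory M q).ops ≤ n + 2 * (m * n) + 3 * (n * n) + m + n := by
  have h1 := ops_table_le (n := n) (fun j => divide (M.z j) q) (c := 1) fun _ => le_rfl
  have h2 := ops_tableMatrix_le (m := m) (n := n) (fun i j => do
    let p ← times (M.y i) (M.z j / q)
    plus (M.A i j) p) (c := 2) fun _ _ => le_rfl
  have h3 := ops_tableMatrix_le (m := n) (n := n) (fun j l => do
    let p ← times (M.z j) (M.z l / q)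
    let r ← times 3 p
    plus (M.F j l) r) (c := 3) fun _ _ => le_rfl
  have h4 := ops_table_le (n := m) (fun i => times 2 (M.y i)) (c := 1) fun _ => le_rfl
  have h5 := ops_table_le (n := n) (fun j => times 4 (M.z j)) (c := 1) fun _ => le_rfl
  have h6 : (rescaleMemory M q).ops = _ + (_ + (_ + (_ + (_ + 0)))) := rfl
  rw [h6]
  have e1 : m * (n * 2) = 2 * (m * n) := by ring
  have e2 : n * (n * 3) = 3 * (n * n) := by ring
  rw [e1] at h2
  rw [e2] at h3
  refine (Nat.add_le_add h1 (Nat.add_le_add h2 (Nat.add_le_add h3 (Nat.add_le_add h4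
    (Nat.add_le_add_right h5 0))))).trans (by omega)

/-- An iteration of the program carries out a step of the algorithm. -/
theorem iteration_spec (h : Represents A₀ M s) (hP : ∀ x, P *ᵥ x = projKer A₀ x) (hy : s.y ≠ 0)
    (hm : 0 < m) (hn : 0 < n) (σ : Equiv.Perm (Fin n)) :
    ∃ k, s.IsArgmin k ∧
      ((s.cosine k < -eps m ∧ Represents A₀ (iteration σ P M).val (s.update k) ∧
          (iteration σ P M).ops ≤ 10 * n + 4 * m + 7) ∨
        (¬ s.cosine k < -eps m ∧ Represents A₀ (iteration σ P M).val s.rescale ∧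
          (iteration σ P M).ops ≤ 8 * n + 2 * (m * n) + 3 * (n * n) + 3 * m + 5)) := by
  obtain ⟨k, hk, hmin⟩ := val_leastScore σ M hn
  have hpos := enorm2_pos.2 hy
  have hscore : ∀ j, (score (M.z j) (M.F j j)).val
      = (enorm2 s.y * s.cosine j) * |enorm2 s.y * s.cosine j| := fun j => by
    rw [h.z_eq, h.F_eq, val_score]
    rfl
  have harg : s.IsArgmin k := fun j => by
    have h1 := hmin j
    rw [hscore, hscore] at h1
    exact le_of_mul_le_mul_left (mul_abs_self_strictMono.le_iff_le.1 h1) hpos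
  have htest : (score (M.z k) (M.F k k)).val
      < 0 - (s.y ⬝ᵥ s.y) / ((11 * (m : ℝ)) * (11 * (m : ℝ))) ↔ s.cosine k < -eps m := by
    -- The threshold of the program is the signed square of `-ε ‖y‖`, on the same scale as the
    -- scores.
    have h1 : 0 - (s.y ⬝ᵥ s.y) / ((11 * (m : ℝ)) * (11 * (m : ℝ)))
        = (enorm2 s.y * -eps m) * |enorm2 s.y * -eps m| := by
      rw [abs_of_nonpos (mul_nonpos_of_nonneg_of_nonpos hpos.le (by linarith [eps_nonneg m])),
        ← enorm2_sq]
      have hm' : (m : ℝ) ≠ 0 := by exact_mod_cast hm.ne'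
      unfold eps
      field_simp
      ring
    rw [h1, hscore, mul_abs_self_strictMono.lt_iff_lt, mul_lt_mul_iff_right₀ hpos]
  have hq : (Counted.inner M.y M.y).val = s.y ⬝ᵥ s.y := by rw [val_inner, h.y_eq]
  have hq' := ops_inner_le M.y M.y
  have hls := ops_leastScore_le σ M
  refine ⟨k, harg, ?_⟩
  by_cases hc : s.cosine k < -eps m
  · have hval : (iteration σ P M).val = (updateMemory P M k).val := by
      unfold iteration
      rw [val_bind, hk]
      simp only [val_bind, times, divide, minus, less, hq, htest.2 hc, decide_true, if_true]
    have hops : (iteration σ P M).ops = (leastScore σ M).ops + ((Counted.inner M.y M.y).ops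
        + (1 + (1 + (1 + (1 + (1 + (updateMemory P M k).ops)))))) := by
      unfold iteration
      rw [ops_bind, hk]
      simp only [ops_bind, times, divide, minus, less, hq, htest.2 hc, decide_true, if_true]
    refine Or.inl ⟨hc, hval ▸ h.updateMemory hP k, ?_⟩
    have := ops_updateMemory_le P M k
    omega
  · have hval : (iteration σ P M).val = (rescaleMemory M (s.y ⬝ᵥ s.y)).val := by
      unfold iteration
      rw [val_bind, hk]
      simp only [val_bind, times, divide, minus, less, hq, mt htest.1 hc, decide_false]
      rfl
    have hops : (iteration σ P M).ops = (leastScore σ M).ops + ((Counted.inner M.y M.y).ops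
        + (1 + (1 + (1 + (1 + (1 + (rescaleMemory M (s.y ⬝ᵥ s.y)).ops)))))) := by
      unfold iteration
      rw [ops_bind, hk]
      simp only [ops_bind, times, divide, minus, less, hq, mt htest.1 hc, decide_false]
      rfl
    refine Or.inr ⟨hc, hval ▸ h.rescaleMemory hy, ?_⟩
    have := ops_rescaleMemory_le M (s.y ⬝ᵥ s.y)
    omega

/-- Induction on the remaining fuel `j`: since a state that does not stop has `R + U < B`, the state
at `j = 0` must stop, and `j + 1` tests suffice. The costs of the steps already taken stand on the
left to avoid subtraction. The rates are those of `iteration_spec` plus `n` for the loop test, and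
the final `n` pays for the successful test. -/
theorem loop_spec (hP : ∀ x, P *ᵥ x = projKer A₀ x) (hm : 0 < m) (hn : 0 < n) {B : ℕ}
    (hB : ∀ R U s, Reach A₀ R U s → ¬ Stops A₀ s → R + U < B) (σ : ℕ → Equiv.Perm (Fin n))
    (j : ℕ) : ∀ (t R U : ℕ) (M : Memory ℝ m n) (s : State m n), Represents A₀ M s →
      Reach A₀ R U s → R + U + j = B →
      ∃ R' U' s', Reach A₀ R' U' s' ∧ Stops A₀ s' ∧
        (loop P σ (j + 1) t M).val = some (projKer A₀ s'.x) ∧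
        (loop P σ (j + 1) t M).ops + R * (9 * n + 2 * (m * n) + 3 * (n * n) + 3 * m + 5)
            + U * (11 * n + 4 * m + 7)
          ≤ R' * (9 * n + 2 * (m * n) + 3 * (n * n) + 3 * m + 5)
            + U' * (11 * n + 4 * m + 7) + n := by
  induction j with
  | zero =>
    intro t R U M s hM hs hRU
    have hfin : Stops A₀ s := by
      by_contra h
      have := hB R U s hs h
      omega
    have hpos : (allPos M.xbar).val = true := by
      rw [val_allPos, hM.xbar_eq]; exact hfin
    refine ⟨R, U, s, hs, hfin, ?_, ?_⟩
    · rw [loop, val_bind, hpos, if_pos rfl, val_pure, hM.xbar_eq]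
    · rw [loop, ops_bind, hpos, if_pos rfl, ops_pure]
      have := ops_allPos_le M.xbar
      omega
  | succ j ih =>
    intro t R U M s hM hs hRU
    have hops := ops_allPos_le M.xbar
    by_cases hfin : Stops A₀ s
    · have hpos : (allPos M.xbar).val = true := by
        rw [val_allPos, hM.xbar_eq]; exact hfin
      refine ⟨R, U, s, hs, hfin, ?_, ?_⟩
      · rw [loop, val_bind, hpos, if_pos rfl, val_pure, hM.xbar_eq]
      · rw [loop, ops_bind, hpos, if_pos rfl, ops_pure]
        omega
    · have hpos : ¬ (allPos M.xbar).val = true := by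
        rw [val_allPos, hM.xbar_eq]; exact hfin
      obtain ⟨k, hk, ⟨hc, hrep, hcost⟩ | ⟨hc, hrep, hcost⟩⟩ :=
        iteration_spec hM hP (hs.y_ne_zero hfin) hm hn (σ t)
      · obtain ⟨R', U', s', h1, h2, h3, h4⟩ := ih (t + 1) R (U + 1) _ _ hrep
          (.update k hs hfin hk hc) (by omega)
        refine ⟨R', U', s', h1, h2, ?_, ?_⟩
        · rw [loop, val_bind, if_neg hpos, val_bind, h3]
        · rw [loop, ops_bind, if_neg hpos, ops_bind]
          rw [Nat.succ_mul U] at h4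
          omega
      · obtain ⟨R', U', s', h1, h2, h3, h4⟩ := ih (t + 1) (R + 1) U _ _ hrep
          (.rescale k hs hfin hk hc) (by omega)
        refine ⟨R', U', s', h1, h2, ?_, ?_⟩
        · rw [loop, val_bind, if_neg hpos, val_bind, h3]
        · rw [loop, ops_bind, if_neg hpos, ops_bind]
          rw [Nat.succ_mul R] at h4
          omega

end Memory

/-- The operation count in terms of the numbers of rescalings and updates. -/
theorem operation_bound {m n L R U : ℕ} (hm : 0 < m) (hn : 0 < n) (hL : 0 < L)
    (hR : R ≤ 6 * (min m n * L)) (hU : U ≤ 2178 * (m ^ 2 * (min m n * L))) :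
    m * (n * (n * 2) + n * 2 + 1 + n * (n * 3))
      + (m * (n * 2) + (n * (n * (m * 2)) + (n * (m * 2) + n * (n * 2)))
      + (R * (9 * n + 2 * (m * n) + 3 * (n * n) + 3 * m + 5) + U * (11 * n + 4 * m + 7) + n))
      ≤ 200000 * ((m ^ 3 * n + m * n ^ 2) * L) := by
  have hd1 : min m n ≤ m := min_le_left _ _
  have hd2 : min m n ≤ n := min_le_right _ _
  generalize min m n = d at *
  have hmn : 1 ≤ m * n := Nat.mul_pos hm hn
  have hfix : m * (n * (n * 2) + n * 2 + 1 + n * (n * 3))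
      + (m * (n * 2) + (n * (n * (m * 2)) + (n * (m * 2) + n * (n * 2)))) + n
      ≤ 17 * (m * n ^ 2 * L) := by
    have a1 : m * n ≤ m * n ^ 2 := Nat.mul_le_mul_left _ (Nat.le_self_pow two_ne_zero n)
    have a2 : n ^ 2 ≤ m * n ^ 2 := Nat.le_mul_of_pos_left _ hm
    have a3 : m * n ^ 2 ≤ m * n ^ 2 * L := Nat.le_mul_of_pos_right _ hL
    have a4 : m ≤ m * n := Nat.le_mul_of_pos_right _ hn
    have a5 : n ≤ m * n := Nat.le_mul_of_pos_left _ hm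
    nlinarith
  have hRc : R * (9 * n + 2 * (m * n) + 3 * (n * n) + 3 * m + 5) ≤ 132 * (m * n ^ 2 * L) := by
    have b1 : 9 * n + 2 * (m * n) + 3 * (n * n) + 3 * m + 5 ≤ 17 * (n * n) + 5 * (m * n) := by
      nlinarith [Nat.le_mul_of_pos_right m hn, Nat.le_mul_of_pos_right n hn]
    calc R * (9 * n + 2 * (m * n) + 3 * (n * n) + 3 * m + 5)
        ≤ 6 * (d * L) * (17 * (n * n) + 5 * (m * n)) := Nat.mul_le_mul hR b1
      _ = 102 * (d * (n ^ 2 * L)) + 30 * (d * (m * n * L)) := by ring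
      -- The minimum `d` is replaced by `m` next to `n²` and by `n` next to `m n`, so that both
      -- terms become `m n² L`.
      _ ≤ 102 * (m * (n ^ 2 * L)) + 30 * (n * (m * n * L)) :=
          Nat.add_le_add (Nat.mul_le_mul_left _ (Nat.mul_le_mul_right _ hd1))
            (Nat.mul_le_mul_left _ (Nat.mul_le_mul_right _ hd2))
      _ = _ := by ring
  have hUc : U * (11 * n + 4 * m + 7) ≤ 2178 * 22 * (m ^ 3 * n * L) := by
    have b1 : 11 * n + 4 * m + 7 ≤ 18 * n + 4 * m := by omega
    calc U * (11 * n + 4 * m + 7) ≤ 2178 * (m ^ 2 * (d * L)) * (18 * n + 4 * m) :=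
          Nat.mul_le_mul hU b1
      _ = 2178 * 18 * (d * (m ^ 2 * n * L)) + 2178 * 4 * (d * (m ^ 3 * L)) := by ring
      -- Likewise `d ≤ m` next to `m² n` and `d ≤ n` next to `m³` both give `m³ n L`.
      _ ≤ 2178 * 18 * (m * (m ^ 2 * n * L)) + 2178 * 4 * (n * (m ^ 3 * L)) :=
          Nat.add_le_add (Nat.mul_le_mul_left _ (Nat.mul_le_mul_right _ hd1))
            (Nat.mul_le_mul_left _ (Nat.mul_le_mul_right _ hd2))
      _ = _ := by ring
  -- The coefficients obtained are `17 + 132` for `m n² L` and `2178 · 22 = 47916` for `m³ n L`; the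
  -- constant 200000 is generous.
  have hM := Nat.zero_le (m ^ 3 * n * L)
  have hN := Nat.zero_le (m * n ^ 2 * L)
  linarith

end FullSupportKernel

open FullSupportKernel in
theorem corollary2p5 :
    ∃ C : ℕ, ∀ (m n : ℕ), 0 < m → 0 < n → ∀ A : Matrix (Fin m) (Fin n) ℤ,
      goffin (A.map (Int.cast : ℤ → ℝ)) < 0 →
      -- on the normalized matrix the algorithm has no infinite run, however ties are resolved
      (¬ ∃ s : ℕ → State m n, s 0 = start (hatMatrix (A.map (Int.cast : ℤ → ℝ))) ∧
        ∀ t, Step (hatMatrix (A.map (Int.cast : ℤ → ℝ))) (s t) (s (t + 1))) ∧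
      -- every vector that it can return is a positive kernel vector
      (∀ xbar, Returns (hatMatrix (A.map (Int.cast : ℤ → ℝ))) xbar →
        KernelFeasible (hatMatrix (A.map (Int.cast : ℤ → ℝ))) xbar) ∧
      -- the program halts, returns such a vector, and respects the operation bound
      (∀ σ : ℕ → Equiv.Perm (Fin n), ∃ (T : ℕ) (xbar : Fin n → ℝ),
        (kernelProgram σ T (hatMatrix (A.map (Int.cast : ℤ → ℝ)))).val = some xbar ∧
        Returns (hatMatrix (A.map (Int.cast : ℤ → ℝ))) xbar ∧
        KernelFeasible (hatMatrix (A.map (Int.cast : ℤ → ℝ))) xbar ∧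
        (kernelProgram σ T (hatMatrix (A.map (Int.cast : ℤ → ℝ)))).ops ≤
          C * ((m ^ 3 * n + m * n ^ 2) * encodingSize A)) := by
  refine ⟨200000, fun m n hm hn A hA =>
    ⟨not_exists_infinite_run hA hm hn, fun _ h => h.kernelFeasible, fun σ => ?_⟩⟩
  set V := hatMatrix (A.map (Int.cast : ℤ → ℝ)) with hV
  set B := 6 * (min m n * encodingSize A) + 2178 * (m ^ 2 * (min m n * encodingSize A)) with hBdef
  have hB : ∀ R U s, Reach V R U s → ¬ Stops V s → R + U < B := fun R U s h hs =>
    add_lt_add_of_le_of_lt (h.rescalings_le hA hm hn) (h.updates_lt_of_goffin hs hA hm hn)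
  have hP := kernelProjection_mulVec V
  -- The loop starts with nothing done and fuel `B`, the bound on the total number of iterations.
  obtain ⟨R, U, s, h1, h2, h3, h4⟩ := loop_spec hP hm hn hB σ B 0 0 0 _ _
    (represents_prepare hP) .start (by omega)
  have hret : Returns V (projKer V s.x) := ⟨s, h1.reflTransGen, h2, rfl⟩
  refine ⟨B + 1, projKer V s.x, h3, hret, hret.kernelFeasible, ?_⟩
  have hL : 0 < encodingSize A := lt_of_lt_of_le (Nat.mul_pos hm hn) (mul_le_encodingSize A)
  refine le_trans ?_ (operation_bound hm hn hL (h1.rescalings_le hA hm hn)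
    (h1.updates_le hA hm hn))
  refine Nat.add_le_add (ops_kernelProjection_le V) (Nat.add_le_add (ops_prepare_le V _) ?_)
  simpa using h4
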